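/- All graphs are finite and simple. A *separating matching* of a graph $G$ is a matching $M$ such that $G-M$ (the edges of $M$ are deleted) has more connected components than $G$; $\mathrm{mms}(G)$ is the maximum number of edges of a separating matching of $G$, and $\mathrm{mms}(G)=0$ if there is none. An *almost $2$-factor* of $G$ is a disconnected spanning subgraph of $G$ in which exactly two vertices have degree $3$ and all other vertices have degree $2$. For cubic graphs $G_1,G_2$ and vertices $u\in V(G_1)$, $v\in V(G_2)$, a *star product* $(G_1,u)*(G_2,v)$ is any graph obtained from the disjoint union of $G_1-u$ and $G_2-v$ by joining the three neighbours of $u$ to the three neighbours of $v$ by a matching of size three. Let $H_0$ be the Heawood graph, and let $\mathcal F$ be the class of all graphs $G$ for which there is a sequence $G_0,\dots,G_m$ such that $G_0\in\{H_0,K_{3,3}\}$, each $G_{i+1}$ is a star product of $G_i$ with $H_0$ or with $K_{3,3}$, and $G_m\cong G$. For $k\in\{0,1,2,3\}$ let $\overline F_k$ be the graph on $6+4k$ vertices obtained from $K_{3,3}$ by replacing $k$ vertices of one colour class, each by a copy of $K_{2,3}$ whose three vertices of degree $2$ are joined by a matching to the three vertices of the other colour class. **Theorem.** The graphs $\overline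 F_0,\overline F_1,\overline F_2,\overline F_3$ belong to $\mathcal F$. For every graph $G\in\mathcal F$ on $n$ vertices, $$\mathrm{mms}(G)\ge \frac n2-1 \iff G\not\cong\overline F_k\ \text{ for all } k\in\{0,1,2,3\} \iff G \text{ has an almost } 2\text{-factor}.$$ In particular, every graph in $\mathcal F$ other than these four has $\mathrm{mms}(G)\ge n/2-1$, and these four do not. -/

import Mathlib

universe u v

namespace SeparatingMatching

variable {V : Type u} {W : Type v}

/-- A separating matching of a graph: a matching whose removal (of its edges) increases the number
of connected components. -/
def IsSeparatingMatching (G : SimpleGraph V) (M : G.Subgraph) : Prop :=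
  M.IsMatching ∧
    Nat.card G.ConnectedComponent < Nat.card (G.deleteEdges M.edgeSet).ConnectedComponent

/-- The maximum number of edges of a separating matching of a (finite) graph; it is `0` if there is
no separating matching. -/
noncomputable def mms (G : SimpleGraph V) : ℕ :=
  sSup {k : ℕ | ∃ M : G.Subgraph, IsSeparatingMatching G M ∧ M.edgeSet.ncard = k}

/-- An almost 2-factor of `G`: a disconnected spanning subgraph with exactly two vertices of
degree `3` in which all other vertices have degree `2`. -/
def IsAlmostTwoFactor (G H : SimpleGraph V) : Prop :=
  H ≤ G ∧ ¬ H.Connected ∧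
    {x : V | (H.neighborSet x).ncard = 3}.ncard = 2 ∧
    ∀ x : V, (H.neighborSet x).ncard ≠ 3 → (H.neighborSet x).ncard = 2

/-- The star product `(G₁, a) * (G₂, b)` in which the neighbours of `a` are joined to the
neighbours of `b` by the matching `σ`: the disjoint union of `G₁ - a` and `G₂ - b` together with
the edges from `x` to `σ x`, for `x` a neighbour of `a`. -/
def starProduct (G₁ : SimpleGraph V) (G₂ : SimpleGraph W) (a : V) (b : W)
    (σ : G₁.neighborSet a ≃ G₂.neighborSet b) :
    SimpleGraph ({x : V // x ≠ a} ⊕ {y : W // y ≠ b}) :=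
  SimpleGraph.fromRel fun p q =>
    match p, q with
    | .inl x, .inl x' => G₁.Adj x x'
    | .inr y, .inr y' => G₂.Adj y y'
    | .inl x, .inr y => ∃ h : (x : V) ∈ G₁.neighborSet a, (σ ⟨x, h⟩ : W) = y
    | .inr _, .inl _ => False

/-- The complete bipartite graph `K_{3,3}`. -/
abbrev K33 : SimpleGraph (Fin 3 ⊕ Fin 3) := completeBipartiteGraph (Fin 3) (Fin 3)

/-- The Heawood graph: the incidence graph of the Fano plane, whose points are `p ∈ ℤ/7` and whose
lines are the translates `{l, l + 1, l + 3}`, `l ∈ ℤ/7`. -/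
def heawood : SimpleGraph (ZMod 7 ⊕ ZMod 7) :=
  SimpleGraph.fromRel fun s t =>
    match s, t with
    | .inl p, .inr l => p = l ∨ p = l + 1 ∨ p = l + 3
    | _, _ => False

/-- The class (closed under isomorphism) of the graphs that arise from the Heawood graph or
`K_{3,3}` by applying finitely many times the star product with the Heawood graph or `K_{3,3}`. -/
inductive FunkClass : {V : Type u} → SimpleGraph V → Prop
  | heawood {V : Type u} {G : SimpleGraph V} (e : G ≃g SeparatingMatching.heawood) : FunkClass G
  | k33 {V : Type u} {G : SimpleGraph V} (e : G ≃g K33) : FunkClass G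
  | starHeawood {V V' : Type u} {G : SimpleGraph V} {G' : SimpleGraph V'} (hG : FunkClass G)
      (a : V) (b : ZMod 7 ⊕ ZMod 7)
      (σ : G.neighborSet a ≃ SeparatingMatching.heawood.neighborSet b)
      (e : G' ≃g starProduct G SeparatingMatching.heawood a b σ) : FunkClass G'
  | starK33 {V V' : Type u} {G : SimpleGraph V} {G' : SimpleGraph V'} (hG : FunkClass G)
      (a : V) (b : Fin 3 ⊕ Fin 3) (σ : G.neighborSet a ≃ K33.neighborSet b)
      (e : G' ≃g starProduct G K33 a b σ) : FunkClass G'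

/-- The four exceptional graphs, on `6`, `10`, `14` and `18` vertices: `Fbar k` is obtained from
`K_{3,3}` by replacing `k` vertices of one colour class, each by a copy of `K_{2,3}` whose three
vertices of degree `2` are matched to the three vertices of the other colour class.
The first summand is the untouched colour class, the second one holds the `k` copies of `K_{2,3}`,
and the third one the `3 - k` vertices that are not replaced. -/
def Fbar (k : Fin 4) :
    SimpleGraph (Fin 3 ⊕ (Fin (k : ℕ) × (Fin 3 ⊕ Fin 2)) ⊕ Fin (3 - (k : ℕ))) :=
  SimpleGraph.fromRel fun s t =>
    match s, t with
    | .inl i, .inr (.inl (_, .inl i')) => i = i'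
    | .inr (.inl (j, .inl _)), .inr (.inl (j', .inr _)) => j = j'
    | .inl _, .inr (.inr _) => True
    | _, _ => False

end SeparatingMatching

open SeparatingMatching

/-! In a connected cubic graph the edges outside an almost 2-factor form a matching that misses
exactly the two cubic vertices. It has `n/2 - 1` edges and its deletion leaves the almost 2-factor,
which is disconnected; so an almost 2-factor gives the bound on `mms`. Two facts close the circle of
implications: the exceptional graphs violate the bound, and every other graph of the class has an
almost 2-factor.

For the first fact, each colour class of `Fbar k` has `3 + 2k` vertices, so a matching with `n/2 - 1
= 2 + 2k` edges misses at most one vertex of either class. Hence it covers one of the two hubs (the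
vertices on the 2-side) of each copy of `K_{2,3}`, by an edge inside the copy. Each copy then stays
connected and behaves like a single vertex of `K_{3,3}`, and what remains is connected
(`connected_fbar_deleteEdges`).

The second fact is an induction over star products with the invariant `Admissible`. Spanning
subgraphs of the factors that use corresponding edges at the removed vertices can be glued; degrees
survive, and so does disconnectedness of either factor. Since every edge is avoided by a 2-factor, a
subgraph with degree 2 at the removed vertex always extends to the other side. The Heawood graph has
an almost 2-factor with degree 2 at any given vertex, so a product with it always succeeds. A
product with `K_{3,3}` inherits an almost 2-factor from the left factor. If the left factor is some
`Fbar k`, two cases remain: up to an automorphism the removed vertex is an unreplaced one and the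
product is `Fbar (k + 1)`, or `Fbar k` has a disconnected lollipop at that vertex, which combines
with a lollipop of `K_{3,3}` (`starProduct_of_iso_fbar`). -/

namespace SeparatingMatching

/-! ### Gluing spanning subgraphs across a star product -/

section Glue

variable {V : Type u} {W : Type v} {G₁ H₁ : SimpleGraph V} {G₂ H₂ : SimpleGraph W} {a : V} {b : W}

/-- The spanning subgraph of a star product that is glued from spanning subgraphs of the factors. -/
def glue (H₁ : SimpleGraph V) (H₂ : SimpleGraph W) (a : V) (b : W)
    (σ : G₁.neighborSet a ≃ G₂.neighborSet b) :
    SimpleGraph ({x : V // x ≠ a} ⊕ {y : W // y ≠ b}) :=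
  SimpleGraph.fromRel fun p q =>
    match p, q with
    | .inl x, .inl x' => H₁.Adj x x'
    | .inr y, .inr y' => H₂.Adj y y'
    | .inl x, .inr y => H₁.Adj a x ∧ ∃ h : (x : V) ∈ G₁.neighborSet a, (σ ⟨x, h⟩ : W) = y
    | .inr _, .inl _ => False

/-- Spanning subgraphs of the factors that use corresponding edges at the removed vertices. -/
def Compatible (H₁ : SimpleGraph V) (H₂ : SimpleGraph W)
    (σ : G₁.neighborSet a ≃ G₂.neighborSet b) : Prop :=
  ∀ x : G₁.neighborSet a, H₁.Adj a x ↔ H₂.Adj b (σ x)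

/-- The cross edges of `glue` are governed by the left factor alone. Compatibility restores the
symmetry, so that facts about the left side carry over to the right one. -/
theorem Compatible.symm {σ : G₁.neighborSet a ≃ G₂.neighborSet b} (h : Compatible H₁ H₂ σ) :
    Compatible H₂ H₁ σ.symm := fun y => by simpa using (h (σ.symm y)).symm

theorem compatible_self (σ : G₁.neighborSet a ≃ G₂.neighborSet b) : Compatible G₁ G₂ σ :=
  fun x => ⟨fun _ => (σ x).2, fun _ => x.2⟩

variable (σ : G₁.neighborSet a ≃ G₂.neighborSet b)

@[simp] theorem glue_adj_inl_inl (x x' : {x : V // x ≠ a}) :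
    (glue H₁ H₂ a b σ).Adj (.inl x) (.inl x') ↔ H₁.Adj x x' := by
  simp only [glue, SimpleGraph.fromRel_adj]
  constructor
  · rintro ⟨-, h | h⟩
    exacts [h, h.symm]
  · intro h
    refine ⟨?_, Or.inl h⟩
    rintro e
    exact h.ne (congrArg Subtype.val (Sum.inl.inj e))

@[simp] theorem glue_adj_inr_inr (y y' : {y : W // y ≠ b}) :
    (glue H₁ H₂ a b σ).Adj (.inr y) (.inr y') ↔ H₂.Adj y y' := by
  simp only [glue, SimpleGraph.fromRel_adj]
  constructor
  · rintro ⟨-, h | h⟩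
    exacts [h, h.symm]
  · intro h
    refine ⟨?_, Or.inl h⟩
    rintro e
    exact h.ne (congrArg Subtype.val (Sum.inr.inj e))

@[simp] theorem glue_adj_inl_inr (x : {x : V // x ≠ a}) (y : {y : W // y ≠ b}) :
    (glue H₁ H₂ a b σ).Adj (.inl x) (.inr y) ↔
      H₁.Adj a x ∧ ∃ h : (x : V) ∈ G₁.neighborSet a, (σ ⟨x, h⟩ : W) = y := by
  simp [glue, SimpleGraph.fromRel_adj]

@[simp] theorem glue_adj_inr_inl (x : {x : V // x ≠ a}) (y : {y : W // y ≠ b}) :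
    (glue H₁ H₂ a b σ).Adj (.inr y) (.inl x) ↔
      H₁.Adj a x ∧ ∃ h : (x : V) ∈ G₁.neighborSet a, (σ ⟨x, h⟩ : W) = y := by
  rw [SimpleGraph.adj_comm, glue_adj_inl_inr]

theorem starProduct_eq_glue : starProduct G₁ G₂ a b σ = glue G₁ G₂ a b σ := by
  unfold starProduct glue
  congr 1
  funext p q
  rcases p with p | p <;> rcases q with q | q <;> try rfl
  exact propext ⟨fun ⟨h, e⟩ => ⟨h, h, e⟩, fun h => h.2⟩

theorem glue_mono (h₁ : H₁ ≤ G₁) (h₂ : H₂ ≤ G₂) :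
    glue H₁ H₂ a b σ ≤ starProduct G₁ G₂ a b σ := by
  rw [starProduct_eq_glue]
  rintro (p | p) (q | q) h <;> simp only [glue_adj_inl_inl, glue_adj_inr_inr, glue_adj_inl_inr,
    glue_adj_inr_inl] at h ⊢
  exacts [h₁ h, ⟨h₁ h.1, h.2⟩, ⟨h₁ h.1, h.2⟩, h₂ h]

variable {σ}

theorem glue_adj_swap (h : Compatible H₁ H₂ σ) (p q : {x : V // x ≠ a} ⊕ {y : W // y ≠ b}) :
    (glue H₂ H₁ b a σ.symm).Adj p.swap q.swap ↔ (glue H₁ H₂ a b σ).Adj p q := by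
  have key : ∀ (x : {x : V // x ≠ a}) (y : {y : W // y ≠ b}),
      (H₂.Adj b y ∧ ∃ h : (y : W) ∈ G₂.neighborSet b, (σ.symm ⟨y, h⟩ : V) = x) ↔
      (H₁.Adj a x ∧ ∃ h : (x : V) ∈ G₁.neighborSet a, (σ ⟨x, h⟩ : W) = y) := by
    rintro ⟨x, hx⟩ ⟨y, hy⟩
    constructor
    · rintro ⟨h1, h2, rfl⟩
      exact ⟨(h.symm ⟨y, h2⟩).1 h1, (σ.symm ⟨y, h2⟩).2, by simp⟩
    · rintro ⟨h1, h2, rfl⟩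
      exact ⟨(h ⟨x, h2⟩).1 h1, (σ ⟨x, h2⟩).2, by simp⟩
  rcases p with p | p <;> rcases q with q | q <;> simp only [Sum.swap_inl, Sum.swap_inr,
    glue_adj_inl_inl, glue_adj_inr_inr, glue_adj_inl_inr, glue_adj_inr_inl, key]

/-- The factors of a compatible glued graph may be exchanged. -/
def glueSwap (h : Compatible H₁ H₂ σ) : glue H₁ H₂ a b σ ≃g glue H₂ H₁ b a σ.symm where
  toEquiv := Equiv.sumComm _ _
  map_rel_iff' := by
    intro p q
    exact glue_adj_swap h p q

theorem ncard_neighborSet_iso {V' : Type*} {G : SimpleGraph V} {G' : SimpleGraph V'} (e : G ≃g G')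
    (v : V) : (G'.neighborSet (e v)).ncard = (G.neighborSet v).ncard :=
  (Set.ncard_congr' (e.mapNeighborSet v)).symm

/-- The neighbours correspond one to one: a possible neighbour `a` is exchanged for the partner of
`x` under `σ`. -/
theorem ncard_neighborSet_glue_inl (h₁ : H₁ ≤ G₁) (x : {x : V // x ≠ a}) :
    ((glue H₁ H₂ a b σ).neighborSet (.inl x)).ncard = (H₁.neighborSet x).ncard := by
  classical
  let f : V → {x : V // x ≠ a} ⊕ {y : W // y ≠ b} := fun v =>
    if h : v = a then
      if hx : (x : V) ∈ G₁.neighborSet a then .inr ⟨σ ⟨x, hx⟩, (σ ⟨x, hx⟩).2.ne'⟩ else .inl x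
    else .inl ⟨v, h⟩
  have fa (hx : (x : V) ∈ G₁.neighborSet a) : f a = .inr ⟨σ ⟨x, hx⟩, (σ ⟨x, hx⟩).2.ne'⟩ := by
    simp only [f, dif_pos, dif_pos hx]
  have fn (v : V) (hv : v ≠ a) : f v = .inl ⟨v, hv⟩ := by simp only [f, dif_neg hv]
  have himg : (glue H₁ H₂ a b σ).neighborSet (.inl x) = f '' H₁.neighborSet x := by
    ext q
    rcases q with q | q
    · simp only [SimpleGraph.mem_neighborSet, glue_adj_inl_inl, Set.mem_image]
      constructor
      · intro h
        exact ⟨q, h, fn _ q.2⟩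
      · rintro ⟨v, hv, e⟩
        by_cases hva : v = a
        · subst hva
          rw [fa (h₁ hv.symm)] at e
          cases e
        · rw [fn v hva] at e
          cases e
          exact hv
    · simp only [SimpleGraph.mem_neighborSet, glue_adj_inl_inr, Set.mem_image]
      constructor
      · rintro ⟨h, hx, e⟩
        refine ⟨a, h.symm, ?_⟩
        rw [fa hx]
        exact congrArg _ (Subtype.ext e)
      · rintro ⟨v, hv, e⟩
        by_cases hva : v = a
        · subst hva
          rw [fa (h₁ hv.symm)] at e
          exact ⟨hv.symm, h₁ hv.symm, congrArg Subtype.val (Sum.inr.inj e)⟩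
        · rw [fn v hva] at e
          cases e
  rw [himg]
  refine Set.InjOn.ncard_image ?_
  intro v hv w hw e
  by_cases hva : v = a
  · by_cases hwa : w = a
    · rw [hva, hwa]
    · subst hva
      rw [fa (h₁ hv.symm), fn w hwa] at e
      cases e
  · by_cases hwa : w = a
    · subst hwa
      rw [fa (h₁ hw.symm), fn v hva] at e
      cases e
    · rw [fn v hva, fn w hwa] at e
      exact congrArg Subtype.val (Sum.inl.inj e)

theorem ncard_neighborSet_glue_inr (h : Compatible H₁ H₂ σ) (h₂ : H₂ ≤ G₂)
    (y : {y : W // y ≠ b}) :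
    ((glue H₁ H₂ a b σ).neighborSet (.inr y)).ncard = (H₂.neighborSet y).ncard := by
  rw [← ncard_neighborSet_iso (glueSwap h) (.inr y)]
  exact ncard_neighborSet_glue_inl h₂ y

/-- Contracting the right side to the vertex `a` sends each edge of the glued graph to an edge of
`H₁` or to a single vertex. The right side must be nonempty for `a` to be hit. -/
theorem connected_left_of_glue [Nonempty {y : W // y ≠ b}]
    (h : (glue H₁ H₂ a b σ).Connected) : H₁.Connected := by
  let f : {x : V // x ≠ a} ⊕ {y : W // y ≠ b} → V := Sum.elim Subtype.val fun _ => a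
  have hf : ∀ p q, (glue H₁ H₂ a b σ).Reachable p q → H₁.Reachable (f p) (f q) := by
    rintro p q ⟨w⟩
    induction w with
    | nil => exact .rfl
    | @cons p r q hpr _ ih =>
      refine .trans ?_ ih
      rcases p with p | p <;> rcases r with r | r <;> simp at hpr
      · exact hpr.reachable
      · exact hpr.1.symm.reachable
      · exact hpr.1.reachable
      · exact .rfl
  have hs : Function.Surjective f := by
    intro v
    by_cases hv : v = a
    · exact ⟨.inr (Classical.arbitrary _), hv.symm⟩
    · exact ⟨.inl ⟨v, hv⟩, rfl⟩
  have := h.nonempty.map f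
  refine ⟨fun v w => ?_⟩
  obtain ⟨p, rfl⟩ := hs v
  obtain ⟨q, rfl⟩ := hs w
  exact hf p q (h.preconnected p q)

theorem connected_iso {V' : Type*} {G : SimpleGraph V} {G' : SimpleGraph V'} (e : G ≃g G')
    (h : G.Connected) : G'.Connected := e.connected_iff.1 h

theorem connected_right_of_glue [Nonempty {x : V // x ≠ a}] (h : Compatible H₁ H₂ σ)
    (hc : (glue H₁ H₂ a b σ).Connected) : H₂.Connected :=
  connected_left_of_glue (connected_iso (glueSwap h) hc)

/-- A star product is connected if the left factor is, and the right one remains so after the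
removal of a vertex. -/
theorem connected_starProduct (hG₁ : G₁.Connected) (y₀ : {y : W // y ≠ b})
    (hG₂ : ∀ y : {y : W // y ≠ b}, (G₂.induce {y | y ≠ b}).Reachable y y₀) :
    (starProduct G₁ G₂ a b σ).Connected := by
  rw [starProduct_eq_glue]
  have hr : ∀ y : {y : W // y ≠ b}, (glue G₁ G₂ a b σ).Reachable (.inr y) (.inr y₀) := by
    intro y
    let φ : G₂.induce {y | y ≠ b} →g glue G₁ G₂ a b σ :=
      ⟨Sum.inr, fun {p q} hpq => (glue_adj_inr_inr σ p q).2 hpq⟩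
    exact (hG₂ y).map φ
  -- A walk towards `a` is followed up to the vertex before `a`, where a cross edge leads into the
  -- right side.
  have hl : ∀ v w, G₁.Walk v w → w = a → ∀ hv : v ≠ a,
      (glue G₁ G₂ a b σ).Reachable (.inl ⟨v, hv⟩) (.inr y₀) := by
    intro v w p
    induction p with
    | nil => exact fun e hv => absurd e hv
    | @cons v u w hvu p ih =>
      intro e hv
      by_cases hu : u = a
      · subst hu
        have hm : v ∈ G₁.neighborSet u := hvu.symm
        refine .trans (SimpleGraph.Adj.reachable ?_) (hr ⟨σ ⟨v, hm⟩, (σ ⟨v, hm⟩).2.ne'⟩)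
        simpa using hvu.symm
      · refine .trans (SimpleGraph.Adj.reachable ?_) (ih e hu)
        simpa using hvu
  have hall : ∀ p, (glue G₁ G₂ a b σ).Reachable p (.inr y₀) := by
    rintro (⟨v, hv⟩ | y)
    · obtain ⟨p⟩ := hG₁.preconnected v a
      exact hl v a p rfl hv
    · exact hr y
  have : Nonempty ({x : V // x ≠ a} ⊕ {y : W // y ≠ b}) := ⟨.inr y₀⟩
  exact ⟨fun p q => (hall p).trans (hall q).symm⟩

end Glue

/-! ### Extending 2-factors, almost 2-factors and lollipops over a star product -/

section Factors

variable {V : Type u} {W : Type v}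

/-- Every vertex has exactly three neighbours. -/
def IsCubic (G : SimpleGraph V) : Prop := ∀ v, (G.neighborSet v).ncard = 3

/-- Every edge is avoided by some `2`-factor. -/
def EdgesAvoidable (G : SimpleGraph V) : Prop :=
  ∀ x y, G.Adj x y → ∃ H ≤ G, ¬ H.Adj x y ∧ ∀ v, (H.neighborSet v).ncard = 2

/-- All degrees are `2`, except for those of `p` and `q`, which are `3`. -/
def IsBicubic (H : SimpleGraph V) (p q : V) : Prop :=
  p ≠ q ∧ (H.neighborSet p).ncard = 3 ∧ (H.neighborSet q).ncard = 3 ∧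
    ∀ v, v ≠ p → v ≠ q → (H.neighborSet v).ncard = 2

/-- All degrees are `2`, except for that of `a`, which is `1`, and that of `y`, which is `3`. -/
def IsLollipop (H : SimpleGraph V) (a y : V) : Prop :=
  a ≠ y ∧ (H.neighborSet a).ncard = 1 ∧ (H.neighborSet y).ncard = 3 ∧
    ∀ v, v ≠ a → v ≠ y → (H.neighborSet v).ncard = 2

theorem IsBicubic.symm {H : SimpleGraph V} {p q : V} (h : IsBicubic H p q) : IsBicubic H q p :=
  ⟨h.1.symm, h.2.2.1, h.2.1, fun v hq hp => h.2.2.2 v hp hq⟩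

theorem isAlmostTwoFactor_iff {G H : SimpleGraph V} :
    IsAlmostTwoFactor G H ↔ H ≤ G ∧ ¬ H.Connected ∧ ∃ p q, IsBicubic H p q := by
  unfold IsAlmostTwoFactor
  refine and_congr_right fun _ => and_congr_right fun _ => ?_
  constructor
  · rintro ⟨h, h2⟩
    obtain ⟨p, q, hpq, hs⟩ := Set.ncard_eq_two.1 h
    have hm : ∀ v, (H.neighborSet v).ncard = 3 ↔ v = p ∨ v = q := fun v => by
      simpa using Set.ext_iff.1 hs v
    refine ⟨p, q, hpq, (hm p).2 (.inl rfl), (hm q).2 (.inr rfl), fun v hp hq => h2 v ?_⟩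
    rw [Ne, hm]
    tauto
  · rintro ⟨p, q, hpq, hp, hq, h2⟩
    have hm : ∀ v, (H.neighborSet v).ncard = 3 ↔ v = p ∨ v = q := by
      intro v
      constructor
      · intro h
        by_contra hv
        have := h2 v (fun h => hv (.inl h)) (fun h => hv (.inr h))
        omega
      · rintro (rfl | rfl) <;> assumption
    refine ⟨Set.ncard_eq_two.2 ⟨p, q, hpq, Set.ext fun v => by simpa using hm v⟩, fun v hv => ?_⟩
    rw [Ne, hm] at hv
    exact h2 v (fun h => hv (.inl h)) (fun h => hv (.inr h))

theorem exists_missing_neighbor {G H : SimpleGraph V} (hH : H ≤ G) {a : V}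
    (hG : (G.neighborSet a).ncard = 3) (ha : (H.neighborSet a).ncard = 2) :
    ∃ x, G.Adj a x ∧ ∀ z, G.Adj a z → (H.Adj a z ↔ z ≠ x) := by
  have hsub : H.neighborSet a ⊆ G.neighborSet a := fun z hz => hH hz
  have h1 : (G.neighborSet a \ H.neighborSet a).ncard = 1 := by
    rw [Set.ncard_sdiff hsub (Set.finite_of_ncard_ne_zero (by omega))]
    omega
  obtain ⟨x, hx⟩ := Set.ncard_eq_one.1 h1
  have hm : ∀ z, (G.Adj a z ∧ ¬ H.Adj a z) ↔ z = x := fun z => by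
    simpa using Set.ext_iff.1 hx z
  refine ⟨x, ((hm x).2 rfl).1, fun z hz => ?_⟩
  rw [Ne, ← hm z]
  tauto

theorem exists_only_neighbor {H : SimpleGraph V} {a : V} (ha : (H.neighborSet a).ncard = 1) :
    ∃ x, ∀ z, H.Adj a z ↔ z = x := by
  obtain ⟨x, hx⟩ := Set.ncard_eq_one.1 ha
  exact ⟨x, fun z => by simpa using Set.ext_iff.1 hx z⟩

theorem adj_of_ncard_eq_three {G H : SimpleGraph V} (hH : H ≤ G) {a : V}
    (hG : (G.neighborSet a).ncard = 3) (ha : (H.neighborSet a).ncard = 3) {z : V}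
    (hz : G.Adj a z) : H.Adj a z := by
  have hsub : H.neighborSet a ⊆ G.neighborSet a := fun z hz => hH hz
  have := Set.eq_of_subset_of_ncard_le hsub (by omega) (Set.finite_of_ncard_ne_zero (by omega))
  exact this.symm.subset hz

theorem nonempty_ne_of_isCubic {G : SimpleGraph V} (hG : IsCubic G) (a : V) :
    Nonempty {x : V // x ≠ a} := by
  have : (G.neighborSet a).ncard ≠ 0 := by rw [hG a]; decide
  obtain ⟨x, hx⟩ := Set.nonempty_of_ncard_ne_zero this
  exact ⟨⟨x, hx.ne'⟩⟩

variable {G₁ H₁ : SimpleGraph V} {G₂ H₂ : SimpleGraph W} {a : V} {b : W}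
  {σ : G₁.neighborSet a ≃ G₂.neighborSet b}

/-- Degree 2 at `a` means that one edge `ax` is missing. A 2-factor of `G₂` that avoids the edge
from `b` to `σ x` misses exactly this edge at `b`. -/
theorem compatible_of_two (h₁ : H₁ ≤ G₁) (hG₁ : IsCubic G₁)
    (ha : (H₁.neighborSet a).ncard = 2) (hG₂ : EdgesAvoidable G₂) (hc₂ : IsCubic G₂) :
    ∃ H₂ ≤ G₂, Compatible H₁ H₂ σ ∧ ∀ v, (H₂.neighborSet v).ncard = 2 := by
  obtain ⟨x, hx, hx'⟩ := exists_missing_neighbor h₁ (hG₁ a) ha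
  obtain ⟨H₂, h₂, hn, hd⟩ := hG₂ b (σ ⟨x, hx⟩) (σ ⟨x, hx⟩).2
  obtain ⟨y, hy, hy'⟩ := exists_missing_neighbor h₂ (hc₂ b) (hd b)
  have hyx : (σ ⟨x, hx⟩ : W) = y := by
    by_contra h
    exact hn ((hy' _ (σ ⟨x, hx⟩).2).2 h)
  refine ⟨H₂, h₂, fun z => ?_, hd⟩
  rw [hx' z z.2, hy' _ (σ z).2, ← hyx]
  refine not_congr ⟨fun h => ?_, fun h => ?_⟩
  · exact congrArg (fun t => (σ t : W)) (Subtype.ext h)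
  · exact congrArg Subtype.val (σ.injective (Subtype.ext h))

theorem isCubic_starProduct (hG₁ : IsCubic G₁) (hG₂ : IsCubic G₂) :
    IsCubic (starProduct G₁ G₂ a b σ) := by
  rw [starProduct_eq_glue]
  rintro (x | y)
  · rw [ncard_neighborSet_glue_inl le_rfl, hG₁]
  · rw [ncard_neighborSet_glue_inr (compatible_self σ) le_rfl, hG₂]

theorem ncard_neighborSet_glue_eq_two (h₁ : H₁ ≤ G₁) (h₂ : H₂ ≤ G₂) (h : Compatible H₁ H₂ σ)
    (hd₁ : ∀ v, (H₁.neighborSet v).ncard = 2) (hd₂ : ∀ v, (H₂.neighborSet v).ncard = 2) (p) :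
    ((glue H₁ H₂ a b σ).neighborSet p).ncard = 2 := by
  rcases p with x | y
  · rw [ncard_neighborSet_glue_inl h₁, hd₁]
  · rw [ncard_neighborSet_glue_inr h h₂, hd₂]

theorem edgesAvoidable_starProduct (hc₁ : IsCubic G₁) (hc₂ : IsCubic G₂)
    (hG₁ : EdgesAvoidable G₁) (hG₂ : EdgesAvoidable G₂) :
    EdgesAvoidable (starProduct G₁ G₂ a b σ) := by
  have left : ∀ x x', G₁.Adj x x' → ∃ H₁ ≤ G₁, ∃ H₂ ≤ G₂, Compatible H₁ H₂ σ ∧ ¬ H₁.Adj x x' ∧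
      (∀ v, (H₁.neighborSet v).ncard = 2) ∧ ∀ v, (H₂.neighborSet v).ncard = 2 := by
    intro x x' h
    obtain ⟨H₁, h₁, hn, hd₁⟩ := hG₁ x x' h
    obtain ⟨H₂, h₂, hc, hd₂⟩ := compatible_of_two (σ := σ) h₁ hc₁ (hd₁ a) hG₂ hc₂
    exact ⟨H₁, h₁, H₂, h₂, hc, hn, hd₁, hd₂⟩
  -- A cross edge at `x` stands for the edge `ax` of the left factor, so a 2-factor avoiding `ax`
  -- avoids it.
  have cut : ∀ (x : {x : V // x ≠ a}), G₁.Adj a x → ∀ q : {y : W // y ≠ b},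
      ∃ H ≤ starProduct G₁ G₂ a b σ, ¬ H.Adj (.inl x) (.inr q) ∧
        ∀ v, (H.neighborSet v).ncard = 2 := by
    intro x hx q
    obtain ⟨H₁, h₁, H₂, h₂, hc, hn, hd₁, hd₂⟩ := left _ _ hx
    exact ⟨glue H₁ H₂ a b σ, glue_mono σ h₁ h₂, fun h => hn ((glue_adj_inl_inr σ x q).1 h).1,
      ncard_neighborSet_glue_eq_two h₁ h₂ hc hd₁ hd₂⟩
  rintro (p | p) (q | q) h
  · rw [starProduct_eq_glue, glue_adj_inl_inl] at h
    obtain ⟨H₁, h₁, H₂, h₂, hc, hn, hd₁, hd₂⟩ := left _ _ h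
    exact ⟨glue H₁ H₂ a b σ, glue_mono σ h₁ h₂, by simpa using hn,
      ncard_neighborSet_glue_eq_two h₁ h₂ hc hd₁ hd₂⟩
  · rw [starProduct_eq_glue, glue_adj_inl_inr] at h
    exact cut p h.1 q
  · rw [starProduct_eq_glue, glue_adj_inr_inl] at h
    obtain ⟨H, hH, hn, hd⟩ := cut q h.1 p
    exact ⟨H, hH, fun h => hn h.symm, hd⟩
  · rw [starProduct_eq_glue, glue_adj_inr_inr] at h
    obtain ⟨H₂, h₂, hn, hd₂⟩ := hG₂ p q h
    obtain ⟨H₁, h₁, hc, hd₁⟩ := compatible_of_two (σ := σ.symm) h₂ hc₂ (hd₂ b) hG₁ hc₁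
    exact ⟨glue H₁ H₂ a b σ, glue_mono σ h₁ h₂, by simpa using hn,
      ncard_neighborSet_glue_eq_two h₁ h₂ hc.symm hd₁ hd₂⟩

/-- If the right factor has an almost `2`-factor with degree `2` at the removed vertex, then the
star product has an almost `2`-factor. -/
theorem exists_almostTwoFactor_of_right (hc₁ : IsCubic G₁) (hc₂ : IsCubic G₂)
    (hG₁ : EdgesAvoidable G₁) (h₂ : H₂ ≤ G₂) (hd : ¬ H₂.Connected) {p q : W}
    (hb : IsBicubic H₂ p q) (hp : b ≠ p) (hq : b ≠ q) :
    ∃ H, IsAlmostTwoFactor (starProduct G₁ G₂ a b σ) H := by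
  obtain ⟨hpq, hp3, hq3, h2⟩ := hb
  obtain ⟨H₁, h₁, hc, hd₁⟩ := compatible_of_two (σ := σ.symm) h₂ hc₂ (h2 b hp hq) hG₁ hc₁
  have hc := hc.symm
  rw [Equiv.symm_symm] at hc
  have := nonempty_ne_of_isCubic hc₁ a
  refine ⟨glue H₁ H₂ a b σ, isAlmostTwoFactor_iff.2 ⟨glue_mono σ h₁ h₂,
    fun h => hd (connected_right_of_glue hc h), .inr ⟨p, hp.symm⟩, .inr ⟨q, hq.symm⟩,
    by simpa using hpq, ?_, ?_, ?_⟩⟩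
  · rw [ncard_neighborSet_glue_inr hc h₂, hp3]
  · rw [ncard_neighborSet_glue_inr hc h₂, hq3]
  · rintro (x | y) hvp hvq
    · rw [ncard_neighborSet_glue_inl h₁, hd₁]
    · rw [ncard_neighborSet_glue_inr hc h₂]
      exact h2 y (fun e => hvp (congrArg _ (Subtype.ext e)))
        (fun e => hvq (congrArg _ (Subtype.ext e)))

/-- An almost `2`-factor of the left factor extends to the star product. -/
theorem exists_almostTwoFactor_of_left (hc₁ : IsCubic G₁) (hc₂ : IsCubic G₂)
    (hG₂ : EdgesAvoidable G₂) (hB : ∃ H₂ ≤ G₂, ∃ c, IsBicubic H₂ b c)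
    (hG₁ : ∃ H, IsAlmostTwoFactor G₁ H) :
    ∃ H, IsAlmostTwoFactor (starProduct G₁ G₂ a b σ) H := by
  obtain ⟨H₁, hH₁⟩ := hG₁
  obtain ⟨h₁, hd, p, q, hb⟩ := isAlmostTwoFactor_iff.1 hH₁
  have := nonempty_ne_of_isCubic hc₂ b
  -- If `a` itself is cubic, all three cross edges are used. The right factor must then have degree
  -- 3 at `b`, and its other cubic vertex `c` takes over the role of `a`.
  have key : ∀ q, IsBicubic H₁ a q → ∃ H, IsAlmostTwoFactor (starProduct G₁ G₂ a b σ) H := by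
    rintro q ⟨haq, ha3, hq3, h2⟩
    obtain ⟨H₂, h₂, c, hbc, hb3, hc3, h2'⟩ := hB
    have hc : Compatible H₁ H₂ σ := fun z =>
      ⟨fun _ => adj_of_ncard_eq_three h₂ (hc₂ b) hb3 (σ z).2,
        fun _ => adj_of_ncard_eq_three h₁ (hc₁ a) ha3 z.2⟩
    refine ⟨glue H₁ H₂ a b σ, isAlmostTwoFactor_iff.2 ⟨glue_mono σ h₁ h₂,
      fun h => hd (connected_left_of_glue h), .inl ⟨q, haq.symm⟩, .inr ⟨c, hbc.symm⟩,
      by simp, ?_, ?_, ?_⟩⟩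
    · rw [ncard_neighborSet_glue_inl h₁, hq3]
    · rw [ncard_neighborSet_glue_inr hc h₂, hc3]
    · rintro (x | y) hvp hvq
      · rw [ncard_neighborSet_glue_inl h₁]
        exact h2 x x.2 (fun e => hvp (congrArg _ (Subtype.ext e)))
      · rw [ncard_neighborSet_glue_inr hc h₂]
        exact h2' y y.2 (fun e => hvq (congrArg _ (Subtype.ext e)))
  by_cases hp : a = p
  · subst hp
    exact key q hb
  by_cases hq : a = q
  · subst hq
    exact key p hb.symm
  -- In the remaining case `a` has degree 2, and a 2-factor completes the right side.
  obtain ⟨hpq, hp3, hq3, h2⟩ := hb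
  obtain ⟨H₂, h₂, hc, hd₂⟩ := compatible_of_two (σ := σ) h₁ hc₁ (h2 a hp hq) hG₂ hc₂
  refine ⟨glue H₁ H₂ a b σ, isAlmostTwoFactor_iff.2 ⟨glue_mono σ h₁ h₂,
    fun h => hd (connected_left_of_glue h), .inl ⟨p, Ne.symm hp⟩, .inl ⟨q, Ne.symm hq⟩,
    by simpa using hpq, ?_, ?_, ?_⟩⟩
  · rw [ncard_neighborSet_glue_inl h₁, hp3]
  · rw [ncard_neighborSet_glue_inl h₁, hq3]
  · rintro (x | y) hvp hvq
    · rw [ncard_neighborSet_glue_inl h₁]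
      exact h2 x (fun e => hvp (congrArg _ (Subtype.ext e)))
        (fun e => hvq (congrArg _ (Subtype.ext e)))
    · rw [ncard_neighborSet_glue_inr hc h₂, hd₂]

/-- Two lollipops, the left one disconnected, give an almost `2`-factor of the star product. -/
theorem exists_almostTwoFactor_of_lollipop (hc₂ : IsCubic G₂)
    (hL : ∀ n, G₂.Adj b n → ∃ H₂ ≤ G₂, H₂.Adj b n ∧ ∃ c, IsLollipop H₂ b c)
    (h₁ : H₁ ≤ G₁) (hd : ¬ H₁.Connected) {y : V} (hy : IsLollipop H₁ a y) :
    ∃ H, IsAlmostTwoFactor (starProduct G₁ G₂ a b σ) H := by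
  obtain ⟨hay, ha1, hy3, h2⟩ := hy
  have := nonempty_ne_of_isCubic hc₂ b
  obtain ⟨x, hx⟩ := exists_only_neighbor ha1
  have hxG : G₁.Adj a x := h₁ ((hx x).2 rfl)
  -- Only one cross edge is used, so the right lollipop has to leave `b` through the partner of `x`.
  obtain ⟨H₂, h₂, hn, c, hbc, hb1, hc3, h2'⟩ := hL (σ ⟨x, hxG⟩) (σ ⟨x, hxG⟩).2
  obtain ⟨w, hw⟩ := exists_only_neighbor hb1
  have hxw := (hw _).1 hn
  have hc : Compatible H₁ H₂ σ := by
    intro z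
    rw [hx, hw, ← hxw]
    refine ⟨fun h => congrArg (fun t => (σ t : W)) (Subtype.ext h), fun h =>
      congrArg Subtype.val (σ.injective (Subtype.ext h))⟩
  refine ⟨glue H₁ H₂ a b σ, isAlmostTwoFactor_iff.2 ⟨glue_mono σ h₁ h₂,
    fun h => hd (connected_left_of_glue h), .inl ⟨y, hay.symm⟩, .inr ⟨c, hbc.symm⟩,
    by simp, ?_, ?_, ?_⟩⟩
  · rw [ncard_neighborSet_glue_inl h₁, hy3]
  · rw [ncard_neighborSet_glue_inr hc h₂, hc3]
  · rintro (x | y) hvp hvq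
    · rw [ncard_neighborSet_glue_inl h₁]
      exact h2 x x.2 (fun e => hvp (congrArg _ (Subtype.ext e)))
    · rw [ncard_neighborSet_glue_inr hc h₂]
      exact h2' y y.2 (fun e => hvq (congrArg _ (Subtype.ext e)))

end Factors

/-! ### Invariance under isomorphism -/

section Transfer

variable {V : Type u} {W : Type v} {G : SimpleGraph V} {G' : SimpleGraph W}

/-- The spanning subgraph that corresponds to `H` under the isomorphism `e`. -/
def comapIso (e : G ≃g G') (H : SimpleGraph W) : H.comap e ≃g H :=
  SimpleGraph.Iso.comap e.toEquiv H

theorem comap_iso_le (e : G ≃g G') {H : SimpleGraph W} (h : H ≤ G') : H.comap e ≤ G :=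
  fun _ _ hxy => e.map_adj_iff.1 (h hxy)

theorem ncard_neighborSet_comap (e : G ≃g G') (H : SimpleGraph W) (v : V) :
    ((H.comap e).neighborSet v).ncard = (H.neighborSet (e v)).ncard :=
  (ncard_neighborSet_iso (comapIso e H) v).symm

theorem not_connected_comap (e : G ≃g G') {H : SimpleGraph W} (h : ¬ H.Connected) :
    ¬ (H.comap e).Connected := fun hc => h (connected_iso (comapIso e H) hc)

theorem isCubic_iso (e : G ≃g G') (h : IsCubic G') : IsCubic G := fun v => by
  rw [← ncard_neighborSet_iso e v, h]

theorem edgesAvoidable_iso (e : G ≃g G') (h : EdgesAvoidable G') : EdgesAvoidable G := by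
  intro x y hxy
  obtain ⟨H, hH, hn, hd⟩ := h (e x) (e y) (e.map_adj_iff.2 hxy)
  exact ⟨H.comap e, comap_iso_le e hH, hn, fun v => by rw [ncard_neighborSet_comap, hd]⟩

theorem exists_almostTwoFactor_iso (e : G ≃g G') (h : ∃ H, IsAlmostTwoFactor G' H) :
    ∃ H, IsAlmostTwoFactor G H := by
  obtain ⟨H, hH⟩ := h
  obtain ⟨hle, hd, p, q, hpq, hp, hq, h2⟩ := isAlmostTwoFactor_iff.1 hH
  refine ⟨H.comap e, isAlmostTwoFactor_iff.2 ⟨comap_iso_le e hle, not_connected_comap e hd,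
    e.symm p, e.symm q, fun h => hpq (e.symm.injective h), ?_, ?_, fun v hvp hvq => ?_⟩⟩
  · rw [ncard_neighborSet_comap, e.apply_symm_apply, hp]
  · rw [ncard_neighborSet_comap, e.apply_symm_apply, hq]
  · rw [ncard_neighborSet_comap]
    exact h2 _ (fun h => hvp (by rw [← h, e.symm_apply_apply]))
      (fun h => hvq (by rw [← h, e.symm_apply_apply]))

theorem exists_lollipop_iso (e : G ≃g G') {a : V}
    (h : ∃ H ≤ G', ¬ H.Connected ∧ ∃ y, IsLollipop H (e a) y) :
    ∃ H ≤ G, ¬ H.Connected ∧ ∃ y, IsLollipop H a y := by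
  obtain ⟨H, hle, hd, y, hay, ha, hy, h2⟩ := h
  refine ⟨H.comap e, comap_iso_le e hle, not_connected_comap e hd, e.symm y,
    fun h => hay (by rw [h, e.apply_symm_apply]), ?_, ?_, fun v hva hvy => ?_⟩
  · rw [ncard_neighborSet_comap, ha]
  · rw [ncard_neighborSet_comap, e.apply_symm_apply, hy]
  · rw [ncard_neighborSet_comap]
    exact h2 _ (fun h => hva (e.injective h)) (fun h => hvy (by rw [← h, e.symm_apply_apply]))

end Transfer

/-! ### Explicit subgraphs of `K_{3,3}` and of the Heawood graph -/

section Bipartite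

variable {A : Type u} {B : Type v}

/-- The bipartite graph of a Boolean relation. -/
def bipGraph (r : A → B → Bool) : SimpleGraph (A ⊕ B) where
  Adj s t := match s, t with
    | .inl x, .inr y => r x y
    | .inr y, .inl x => r x y
    | _, _ => False
  symm := ⟨by rintro (x | x) (y | y) h <;> exact h⟩
  loopless := ⟨by rintro (x | x) h <;> exact h⟩

theorem bipGraph_mono {r s : A → B → Bool} (h : ∀ x y, r x y → s x y) :
    bipGraph r ≤ bipGraph s := by
  rintro (x | x) (y | y) hxy
  exacts [hxy, h x y hxy, h y x hxy, hxy]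

theorem ncard_setOf {α : Type*} [Fintype α] (f : α → Bool) :
    {x | f x = true}.ncard = (Finset.univ.filter fun x => f x = true).card := by
  rw [← Set.ncard_coe_finset]
  congr 1
  ext
  simp

theorem ncard_neighborSet_bipGraph_inl [Fintype B] (r : A → B → Bool) (x : A) :
    ((bipGraph r).neighborSet (.inl x)).ncard = (Finset.univ.filter fun y => r x y).card := by
  have : (bipGraph r).neighborSet (.inl x) = Sum.inr '' {y | r x y} := by
    ext (y | y)
    · simp [bipGraph]
    · simp [bipGraph]
  rw [this, Set.ncard_image_of_injective _ Sum.inr_injective, ncard_setOf]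

theorem ncard_neighborSet_bipGraph_inr [Fintype A] (r : A → B → Bool) (y : B) :
    ((bipGraph r).neighborSet (.inr y)).ncard = (Finset.univ.filter fun x => r x y).card := by
  have : (bipGraph r).neighborSet (.inr y) = Sum.inl '' {x | r x y} := by
    ext (x | x)
    · simp [bipGraph]
    · simp [bipGraph]
  rw [this, Set.ncard_image_of_injective _ Sum.inl_injective, ncard_setOf (fun x => r x y)]

/-- The degree of a vertex of `bipGraph r`, in computable form. -/
def bipDegree [Fintype A] [Fintype B] (r : A → B → Bool) : A ⊕ B → ℕ
  | .inl x => (Finset.univ.filter fun y => r x y).card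
  | .inr y => (Finset.univ.filter fun x => r x y).card

theorem ncard_neighborSet_bipGraph [Fintype A] [Fintype B] (r : A → B → Bool) (v : A ⊕ B) :
    ((bipGraph r).neighborSet v).ncard = bipDegree r v := by
  rcases v with x | y
  exacts [ncard_neighborSet_bipGraph_inl r x, ncard_neighborSet_bipGraph_inr r y]

theorem not_connected_of_coloring {V : Type*} {H : SimpleGraph V} (c : V → Bool)
    (h : ∀ v w, H.Adj v w → c v = c w) {v w : V} (hvw : c v ≠ c w) : ¬ H.Connected := by
  intro hc
  obtain ⟨p⟩ := hc.preconnected v w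
  apply hvw
  induction p with
  | nil => rfl
  | cons hadj _ ih =>
    rw [h _ _ hadj]
    by_contra hne
    exact hne (ih hne)

theorem K33_eq_bipGraph : K33 = bipGraph fun _ _ => true := by
  ext (x | x) (y | y) <;> simp [bipGraph]

theorem isCubic_K33 : IsCubic K33 := by
  intro v
  rw [K33_eq_bipGraph, ncard_neighborSet_bipGraph]
  revert v
  decide

/-- The differences `j - i` split the edges into three perfect matchings; leaving out the one that
contains the given edge gives a 2-factor. -/
theorem edgesAvoidable_K33 : EdgesAvoidable K33 := by
  have key : ∀ x y, ∃ H ≤ K33, ¬ H.Adj (.inl x) (.inr y) ∧ ∀ v, (H.neighborSet v).ncard = 2 := by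
    intro x y
    refine ⟨bipGraph fun i j => decide (j - i ≠ y - x), ?_, ?_, fun v => ?_⟩
    · rw [K33_eq_bipGraph]
      exact bipGraph_mono fun _ _ _ => rfl
    · simp [bipGraph]
    · rw [ncard_neighborSet_bipGraph]
      revert x y v
      decide
  rintro (x | x) (y | y) h
  · simp at h
  · exact key x y
  · obtain ⟨H, hH, hn, hd⟩ := key y x
    exact ⟨H, hH, fun h => hn h.symm, hd⟩
  · simp at h

/-- The witness is a 6-cycle together with the chord from `b` to `b.swap`. -/
theorem exists_isBicubic_K33 (b : Fin 3 ⊕ Fin 3) : ∃ H ≤ K33, ∃ c, IsBicubic H b c := by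
  refine ⟨bipGraph fun i j => decide (i ≠ j ∨ i = Sum.elim id id b), ?_, b.swap, ?_⟩
  · rw [K33_eq_bipGraph]
    exact bipGraph_mono fun _ _ _ => rfl
  · simp only [IsBicubic, ncard_neighborSet_bipGraph]
    revert b
    decide

/-- The witness is the path from `b` through `n` to the vertex `b + 1` of the same class, followed
by the 4-cycle on the remaining vertices and `b + 1`. -/
theorem exists_isLollipop_K33 (b n : Fin 3 ⊕ Fin 3) (h : K33.Adj b n) :
    ∃ H ≤ K33, H.Adj b n ∧ ∃ c, IsLollipop H b c := by
  rcases b with b | b <;> rcases n with n | n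
  · simp at h
  · refine ⟨bipGraph fun i j => if i = b then j = n else if i = b + 1 then true else j ≠ n, ?_, ?_,
      .inl (b + 1), ?_⟩
    · rw [K33_eq_bipGraph]
      exact bipGraph_mono fun _ _ _ => rfl
    · simp [bipGraph]
    · simp only [IsLollipop, ncard_neighborSet_bipGraph]
      clear h
      revert b n
      decide
  · refine ⟨bipGraph fun j i => if i = b then j = n else if i = b + 1 then true else j ≠ n, ?_, ?_,
      .inr (b + 1), ?_⟩
    · rw [K33_eq_bipGraph]
      exact bipGraph_mono fun _ _ _ => rfl
    · simp [bipGraph]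
    · simp only [IsLollipop, ncard_neighborSet_bipGraph]
      clear h
      revert b n
      decide
  · simp at h

theorem heawood_eq_bipGraph :
    heawood = bipGraph fun p l => decide (p = l ∨ p = l + 1 ∨ p = l + 3) := by
  ext (x | x) (y | y) <;> simp [bipGraph, heawood]

theorem isCubic_heawood : IsCubic heawood := by
  intro v
  rw [heawood_eq_bipGraph, ncard_neighborSet_bipGraph]
  revert v
  decide +kernel

/-- The incidences split into three perfect matchings by the difference `p - l`, which is 0, 1 or 3;
the one containing the given edge is left out. -/
theorem edgesAvoidable_heawood : EdgesAvoidable heawood := by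
  have key : ∀ x y, heawood.Adj (.inl x) (.inr y) →
      ∃ H ≤ heawood, ¬ H.Adj (.inl x) (.inr y) ∧ ∀ v, (H.neighborSet v).ncard = 2 := by
    intro x y h
    rw [heawood_eq_bipGraph] at h ⊢
    refine ⟨bipGraph fun p l => decide ((p = l ∨ p = l + 1 ∨ p = l + 3) ∧ p - l ≠ x - y),
      bipGraph_mono fun p l h => ?_, ?_, fun v => ?_⟩
    · simp only [decide_eq_true_eq] at h ⊢
      exact h.1
    · simp [bipGraph]
    · rw [ncard_neighborSet_bipGraph]
      have hxy : x - y = 0 ∨ x - y = 1 ∨ x - y = 3 := by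
        simp only [bipGraph, decide_eq_true_eq] at h
        rcases h with rfl | rfl | rfl
        · exact .inl (sub_self _)
        · exact .inr (.inl (add_sub_cancel_left _ _))
        · exact .inr (.inr (add_sub_cancel_left _ _))
      generalize x - y = d at hxy
      revert v
      rcases hxy with rfl | rfl | rfl <;> decide +kernel
  rintro (x | x) (y | y) h
  · simp [heawood] at h
  · exact key x y h
  · obtain ⟨H, hH, hn, hd⟩ := key y x h.symm
    exact ⟨H, hH, fun h => hn h.symm, hd⟩
  · simp [heawood] at h

/-- The incidences of the Fano plane that are left out, up to a shift, in an almost `2`-factor. -/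
def heawoodRemoved (p l : ZMod 7) : Bool :=
  (p = l && l.val < 4) || (p = l + 1 && (l = 4 || l = 5))

/-- The point and line side of a component of an almost `2`-factor of the Heawood graph. -/
def heawoodColor : ZMod 7 ⊕ ZMod 7 → Bool :=
  Sum.elim (fun p => p = 0 || p = 2 || p = 4 || p = 6) (fun l => l = 1 || l = 3 || l = 4 || l = 6)

theorem exists_almostTwoFactor_heawood (b : ZMod 7 ⊕ ZMod 7) :
    ∃ H ≤ heawood, ¬ H.Connected ∧ ∃ p q, IsBicubic H p q ∧ b ≠ p ∧ b ≠ q := by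
  have key : ∀ s : ZMod 7, ∃ H ≤ heawood, ¬ H.Connected ∧
      IsBicubic H (.inl (4 + s)) (.inr (6 + s)) := by
    intro s
    refine ⟨bipGraph fun p l => decide (p = l ∨ p = l + 1 ∨ p = l + 3) &&
      !heawoodRemoved (p - s) (l - s), ?_, ?_, ?_⟩
    · rw [heawood_eq_bipGraph]
      refine bipGraph_mono fun p l h => ?_
      rw [Bool.and_eq_true] at h
      exact h.1
    · have hc : ∀ p l : ZMod 7, (decide (p = l ∨ p = l + 1 ∨ p = l + 3) &&
          !heawoodRemoved (p - s) (l - s)) = true →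
          heawoodColor (.inl (p - s)) = heawoodColor (.inr (l - s)) := by
        revert s
        decide +kernel
      refine not_connected_of_coloring
        (fun v => heawoodColor (v.map (fun p => p - s) fun l => l - s)) ?_
        (v := .inl s) (w := .inl (1 + s)) ?_
      · rintro (p | p) (l | l) h
        exacts [h.elim, hc p l h, (hc l p h).symm, h.elim]
      · simp only [Sum.map_inl, sub_self, add_sub_cancel_right]
        decide
    · simp only [IsBicubic, ncard_neighborSet_bipGraph]
      revert s
      decide +kernel
  by_cases hb : b = .inl 4 ∨ b = .inr 6
  · obtain ⟨H, hH, hd, hb'⟩ := key 1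
    refine ⟨H, hH, hd, _, _, hb', ?_⟩
    rcases hb with rfl | rfl <;> decide
  · obtain ⟨H, hH, hd, hb'⟩ := key 0
    refine ⟨H, hH, hd, _, _, hb', ?_⟩
    rw [add_zero, add_zero]
    exact not_or.1 hb

end Bipartite

/-! ### Connectedness after the removal of a vertex -/

section Connected

variable {A : Type u} {B : Type v}

/-- A criterion for a bipartite graph to be connected after the deletion of the vertex `b`. -/
theorem reachable_induce_bipGraph (r : A → B → Bool) (b : A ⊕ B) (p₀ : A) (hp₀ : .inl p₀ ≠ b)
    (hA : ∀ p, .inl p ≠ b → ∃ q, .inl q ≠ b ∧ (∃ l, .inr l ≠ b ∧ r p l ∧ r q l) ∧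
      ∃ l, .inr l ≠ b ∧ r q l ∧ r p₀ l)
    (hB : ∀ l, .inr l ≠ b → ∃ p, .inl p ≠ b ∧ r p l) (y : {y // y ≠ b}) :
    ((bipGraph r).induce {y | y ≠ b}).Reachable y ⟨.inl p₀, hp₀⟩ := by
  have step : ∀ p q l (hp : .inl p ≠ b) (hq : .inl q ≠ b), .inr l ≠ b → r p l → r q l →
      ((bipGraph r).induce {y | y ≠ b}).Reachable ⟨.inl p, hp⟩ ⟨.inl q, hq⟩ := by
    intro p q l hp hq hl hpl hql
    have h1 : ((bipGraph r).induce {y | y ≠ b}).Adj ⟨.inl p, hp⟩ ⟨.inr l, hl⟩ := hpl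
    have h2 : ((bipGraph r).induce {y | y ≠ b}).Adj ⟨.inr l, hl⟩ ⟨.inl q, hq⟩ := hql
    exact h1.reachable.trans h2.reachable
  have left : ∀ p (hp : .inl p ≠ b),
      ((bipGraph r).induce {y | y ≠ b}).Reachable ⟨.inl p, hp⟩ ⟨.inl p₀, hp₀⟩ := by
    intro p hp
    obtain ⟨q, hq, ⟨l, hl, h1, h2⟩, l', hl', h3, h4⟩ := hA p hp
    exact (step p q l hp hq hl h1 h2).trans (step q p₀ l' hq hp₀ hl' h3 h4)
  rcases y with ⟨p | l, h⟩
  · exact left p h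
  · obtain ⟨p, hp, hpl⟩ := hB l h
    have h1 : ((bipGraph r).induce {y | y ≠ b}).Adj ⟨.inr l, h⟩ ⟨.inl p, hp⟩ := hpl
    exact h1.reachable.trans (left p hp)

theorem reachable_induce_K33 (b : Fin 3 ⊕ Fin 3) :
    ∃ y₀ : {y // y ≠ b}, ∀ y : {y // y ≠ b}, (K33.induce {y | y ≠ b}).Reachable y y₀ := by
  rw [K33_eq_bipGraph]
  refine ⟨_, reachable_induce_bipGraph _ b (if b = .inl 0 then 1 else 0) ?_ ?_ ?_⟩ <;>
    revert b <;> decide +kernel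

theorem reachable_induce_heawood (b : ZMod 7 ⊕ ZMod 7) :
    ∃ y₀ : {y // y ≠ b}, ∀ y : {y // y ≠ b}, (heawood.induce {y | y ≠ b}).Reachable y y₀ := by
  rw [heawood_eq_bipGraph]
  refine ⟨_, reachable_induce_bipGraph _ b (if b = .inl 0 then 1 else 0) ?_ ?_ ?_⟩ <;>
    revert b <;> decide +kernel

theorem connected_of_reachable_induce {V : Type*} {G : SimpleGraph V} (hG : IsCubic G) (b : V)
    (h : ∃ y₀ : {y // y ≠ b}, ∀ y : {y // y ≠ b}, (G.induce {y | y ≠ b}).Reachable y y₀) :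
    G.Connected := by
  obtain ⟨y₀, h⟩ := h
  have hne : ∀ y, y ≠ b → G.Reachable y y₀ := fun y hy =>
    (h ⟨y, hy⟩).map (SimpleGraph.Embedding.induce {y | y ≠ b}).toHom
  have hb : G.Reachable b y₀ := by
    have : (G.neighborSet b).ncard ≠ 0 := by rw [hG b]; decide
    obtain ⟨n, hn⟩ := Set.nonempty_of_ncard_ne_zero this
    exact (SimpleGraph.Adj.reachable hn).trans (hne n hn.ne')
  have hall : ∀ y, G.Reachable y y₀ := fun y => by
    by_cases hy : y = b
    · rw [hy]; exact hb
    · exact hne y hy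
  have : Nonempty V := ⟨b⟩
  exact ⟨fun x y => (hall x).trans (hall y).symm⟩

theorem connected_K33 : K33.Connected :=
  connected_of_reachable_induce isCubic_K33 (.inl 0) (reachable_induce_K33 _)

theorem connected_heawood : heawood.Connected :=
  connected_of_reachable_induce isCubic_heawood (.inl 0) (reachable_induce_heawood _)

end Connected

/-! ### Disconnected lollipops in the exceptional graphs -/

section Lollipops

/-- The vertex set of `Fbar k`. -/
abbrev FbarVertex (k : Fin 4) : Type := Fin 3 ⊕ (Fin (k : ℕ) × (Fin 3 ⊕ Fin 2)) ⊕ Fin (3 - (k : ℕ))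

/-- The position, among the three vertices of the second colour class of `K_{3,3}`, of the vertex
that was replaced by the `j`-th copy of `K_{2,3}`. -/
def gadgetSlot {k : Fin 4} (j : Fin (k : ℕ)) : Fin 3 := ⟨j, by omega⟩

/-- The position, among the three vertices of the second colour class of `K_{3,3}`, of a vertex
that was not replaced. -/
def singleSlot {k : Fin 4} (s : Fin (3 - (k : ℕ))) : Fin 3 := ⟨k + s, by omega⟩

/-- The edges of `Fbar k` selected by `P` (between the colour class and the slots) and `Q` (inside
the copies of `K_{2,3}`). -/
def fbarRel (k : Fin 4) (P : Fin 3 → Fin 3 → Bool) (Q : Fin 3 → Fin 3 → Fin 2 → Bool) :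
    FbarVertex k → FbarVertex k → Bool
  | .inl i, .inr (.inl (j, .inl i')) => i = i' && P i (gadgetSlot j)
  | .inr (.inl (j, .inl i)), .inr (.inl (j', .inr c)) => j = j' && Q (gadgetSlot j) i c
  | .inl i, .inr (.inr s) => P i (singleSlot s)
  | _, _ => false

/-- The spanning subgraph of `Fbar k` with the edges selected by `P` and `Q`. -/
def fbarSub (k : Fin 4) (P : Fin 3 → Fin 3 → Bool) (Q : Fin 3 → Fin 3 → Fin 2 → Bool) :
    SimpleGraph (FbarVertex k) :=
  SimpleGraph.fromRel fun s t => fbarRel k P Q s t = true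

theorem fbarRel_irrefl (k : Fin 4) (P : Fin 3 → Fin 3 → Bool) (Q : Fin 3 → Fin 3 → Fin 2 → Bool)
    (s : FbarVertex k) : fbarRel k P Q s s = false := by
  rcases s with i | ⟨j, i | c⟩ | s <;> rfl

theorem fbarSub_adj {k : Fin 4} {P : Fin 3 → Fin 3 → Bool} {Q : Fin 3 → Fin 3 → Fin 2 → Bool}
    {s t : FbarVertex k} :
    (fbarSub k P Q).Adj s t ↔ (fbarRel k P Q s t || fbarRel k P Q t s) = true := by
  rw [fbarSub, SimpleGraph.fromRel_adj, Bool.or_eq_true, and_iff_right_iff_imp]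
  rintro h rfl
  rw [fbarRel_irrefl] at h
  simp at h

theorem fbarSub_le (k : Fin 4) (P : Fin 3 → Fin 3 → Bool) (Q : Fin 3 → Fin 3 → Fin 2 → Bool) :
    fbarSub k P Q ≤ Fbar k := by
  intro s t h
  rw [fbarSub, SimpleGraph.fromRel_adj] at h
  have key : ∀ s t, fbarRel k P Q s t = true → (Fbar k).Adj s t := by
    rintro (i | ⟨j, i | c⟩ | s) (i' | ⟨j', i' | c'⟩ | s') h <;>
      simp_all [fbarRel, Fbar]
  exact h.2.elim (key s t) fun h => (key t s h).symm

/-- The degree of a vertex in `fbarSub`, in computable form. -/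
def fbarDegree (k : Fin 4) (P : Fin 3 → Fin 3 → Bool) (Q : Fin 3 → Fin 3 → Fin 2 → Bool)
    (s : FbarVertex k) : ℕ :=
  (Finset.univ.filter fun t => (fbarRel k P Q s t || fbarRel k P Q t s) = true).card

theorem ncard_neighborSet_fbarSub (k : Fin 4) (P : Fin 3 → Fin 3 → Bool)
    (Q : Fin 3 → Fin 3 → Fin 2 → Bool) (s : FbarVertex k) :
    ((fbarSub k P Q).neighborSet s).ncard = fbarDegree k P Q s := by
  have : (fbarSub k P Q).neighborSet s =
      {t | (fbarRel k P Q s t || fbarRel k P Q t s) = true} := by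
    ext t
    exact fbarSub_adj
  rw [this, ncard_setOf fun t => fbarRel k P Q s t || fbarRel k P Q t s, fbarDegree]

/-- The computable criterion for `fbarSub k P Q` to be a lollipop at `a` with cubic vertex `y`,
disconnected because no edge joins the two classes of the colouring `c`. -/
def LollipopCert (k : Fin 4) (P : Fin 3 → Fin 3 → Bool) (Q : Fin 3 → Fin 3 → Fin 2 → Bool)
    (a y : FbarVertex k) (c : FbarVertex k → Bool) : Prop :=
  a ≠ y ∧ fbarDegree k P Q a = 1 ∧ fbarDegree k P Q y = 3 ∧
    (∀ v, v ≠ a → v ≠ y → fbarDegree k P Q v = 2) ∧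
    (∀ v w, fbarRel k P Q v w = true → c v = c w) ∧ ∃ v, c v ≠ c a

instance (k : Fin 4) (P : Fin 3 → Fin 3 → Bool) (Q : Fin 3 → Fin 3 → Fin 2 → Bool)
    (a y : FbarVertex k) (c : FbarVertex k → Bool) : Decidable (LollipopCert k P Q a y c) := by
  have : ∀ v w : FbarVertex k, Decidable (v = w) := inferInstance
  have : Decidable (∀ v, v ≠ a → v ≠ y → fbarDegree k P Q v = 2) := inferInstance
  have : Decidable (∀ v w, fbarRel k P Q v w = true → c v = c w) := inferInstance
  have : Decidable (∃ v, c v ≠ c a) := inferInstance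
  exact instDecidableAnd

theorem LollipopCert.exists_lollipop {k : Fin 4} {P : Fin 3 → Fin 3 → Bool}
    {Q : Fin 3 → Fin 3 → Fin 2 → Bool} {a y : FbarVertex k} {c : FbarVertex k → Bool}
    (h : LollipopCert k P Q a y c) :
    ∃ H ≤ Fbar k, ¬ H.Connected ∧ ∃ y, IsLollipop H a y := by
  obtain ⟨hay, ha, hy, h2, hc, v, hv⟩ := h
  refine ⟨fbarSub k P Q, fbarSub_le k P Q, not_connected_of_coloring c ?_ hv, y, hay, ?_⟩
  · intro v w h
    rw [fbarSub_adj, Bool.or_eq_true] at h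
    exact h.elim (hc v w) fun h => (hc w v h).symm
  · simp only [ncard_neighborSet_fbarSub]
    exact ⟨ha, hy, h2⟩

/-- The lollipop consists of `i` and the `j`-th copy, less one edge inside it. The other two
vertices of the class and the other two slots form a cycle; a copy in such a slot is traversed along
a path through all its vertices. -/
theorem exists_lollipop_class (k : Fin 4) (j : Fin (k : ℕ)) (i : Fin 3) :
    ∃ H ≤ Fbar k, ¬ H.Connected ∧ ∃ y, IsLollipop H (.inl i) y := by
  have h : LollipopCert k
      (fun i' s => if s = gadgetSlot j then i' = i else i' ≠ i)
      (fun s i' c => if s = gadgetSlot j then !(decide (i' = i) && decide (c = 1))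
        else decide ((i' - i).val + c.val ≠ 2))
      (.inl i) (.inr (.inl (j, .inr 0)))
      (Sum.elim (fun i' => decide (i' = i)) (Sum.elim (fun p => decide (p.1 = j))
        fun _ => false)) := by
    revert k j i
    decide +kernel
  exact h.exists_lollipop

/-- The vertex of `Fbar k` in the slot `s`, namely its `i`-th one if `s` holds a `K_{2,3}`. -/
def slotVertex (k : Fin 4) (s i : Fin 3) : FbarVertex k :=
  if h : s.val < k then .inr (.inl (⟨s, h⟩, .inl i)) else .inr (.inr ⟨s - k, by omega⟩)

/-- The rest of the `j`-th copy is a 4-cycle. Outside it, the lollipop runs from the given vertex to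
`i` and on to the cubic vertex in the next slot, which lies on a cycle through all the rest. -/
theorem exists_lollipop_gadget (k : Fin 4) (j : Fin (k : ℕ)) (i : Fin 3) :
    ∃ H ≤ Fbar k, ¬ H.Connected ∧ ∃ y, IsLollipop H (.inr (.inl (j, .inl i))) y := by
  have h : LollipopCert k
      (fun i' s => if s = gadgetSlot j then i' = i else if s = gadgetSlot j + 1 then true
        else i' ≠ i)
      (fun s i' c => if s = gadgetSlot j then i' ≠ i else decide ((i' - i).val + c.val ≠ 2))
      (.inr (.inl (j, .inl i))) (slotVertex k (gadgetSlot j + 1) i)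
      (Sum.elim (fun _ => false) (Sum.elim (fun p => decide (p.1 = j) && decide (p.2 ≠ .inl i))
        fun _ => false)) := by
    revert k j i
    decide +kernel
  exact h.exists_lollipop

/-- The lollipop runs from the hub through vertex 0 of the class into the copy `j'`, which supplies
its cycle. The other hub of `j`, the vertices 1 and 2 of the class and the third slot lie on a
second cycle. -/
theorem exists_lollipop_hub (k : Fin 4) (j j' : Fin (k : ℕ)) (hj : j ≠ j') (c : Fin 2) :
    ∃ H ≤ Fbar k, ¬ H.Connected ∧ ∃ y, IsLollipop H (.inr (.inl (j, .inr c))) y := by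
  have h : LollipopCert k
      (fun i s => if s = gadgetSlot j then true else if s = gadgetSlot j' then i = 0 else i ≠ 0)
      (fun s i c' => if s = gadgetSlot j then decide (c' = c ↔ i = 0)
        else if s = gadgetSlot j' then !(decide (i = 0) && decide (c' = 1))
        else decide (i.val + c'.val ≠ 2))
      (.inr (.inl (j, .inr c))) (.inr (.inl (j', .inr 0)))
      (Sum.elim (fun i => decide (i = 0)) (Sum.elim
        (fun p => if p.1 = j then decide (p.2 = .inl 0 ∨ p.2 = .inr c) else decide (p.1 = j'))
        fun _ => false)) := by
    revert k j j' c
    decide +kernel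
  exact h.exists_lollipop

end Lollipops

/-! ### Star products of exceptional graphs with `K_{3,3}` -/

section Isomorphisms

/-- The edges of `fbarOn`, each in one direction. -/
def fbarPair {J : Type u} {U : Type v} (s t : Fin 3 ⊕ (J × (Fin 3 ⊕ Fin 2)) ⊕ U) : Prop :=
  match s, t with
  | .inl i, .inr (.inl (_, .inl i')) => i = i'
  | .inr (.inl (j, .inl _)), .inr (.inl (j', .inr _)) => j = j'
  | .inl _, .inr (.inr _) => True
  | _, _ => False

/-- The graph obtained from `K_{3,3}` when the vertices of one colour class are the elements of `J`
and `U`, and those in `J` are replaced by copies of `K_{2,3}`. -/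
def fbarOn (J : Type u) (U : Type v) : SimpleGraph (Fin 3 ⊕ (J × (Fin 3 ⊕ Fin 2)) ⊕ U) :=
  SimpleGraph.fromRel fbarPair

theorem fbarOn_adj {J : Type u} {U : Type v} {s t : Fin 3 ⊕ (J × (Fin 3 ⊕ Fin 2)) ⊕ U} :
    (fbarOn J U).Adj s t ↔ fbarPair s t ∨ fbarPair t s := by
  rw [fbarOn, SimpleGraph.fromRel_adj, and_iff_right_iff_imp]
  rintro h rfl
  rcases s with i | ⟨j, i | c⟩ | s <;> simp [fbarPair] at h

theorem fbar_eq_fbarOn (k : Fin 4) : Fbar k = fbarOn (Fin (k : ℕ)) (Fin (3 - (k : ℕ))) := by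
  ext (i | ⟨j, i | c⟩ | s) (i' | ⟨j', i' | c'⟩ | s') <;> simp [Fbar, fbarOn_adj, fbarPair]

/-- `fbarOn` depends only on the sizes of the index types. -/
def fbarOnCongr {J J' U U' : Type*} (f : J ≃ J') (g : U ≃ U') : fbarOn J U ≃g fbarOn J' U' where
  toEquiv := Equiv.sumCongr (Equiv.refl _) (Equiv.sumCongr (Equiv.prodCongr f (Equiv.refl _)) g)
  map_rel_iff' := by
    rintro (i | ⟨j, i | c⟩ | s) (i' | ⟨j', i' | c'⟩ | s') <;> simp [fbarOn_adj, fbarPair]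

theorem K33_adj_iff (x y : Fin 3 ⊕ Fin 3) : K33.Adj x y ↔ x.isLeft ≠ y.isLeft := by
  rcases x with x | x <;> rcases y with y | y <;> simp

theorem exists_other_of_class (b : Fin 3 ⊕ Fin 3) : ∃ ρ : Fin 2 → Fin 3 ⊕ Fin 3,
    Function.Injective ρ ∧ ∀ c, ρ c ≠ b ∧ (ρ c).isLeft = b.isLeft := by
  refine ⟨fun c => b.map (fun i => if c = 0 then i + 1 else i + 2)
    (fun i => if c = 0 then i + 1 else i + 2), ?_⟩
  revert b
  decide

/-- `K_{3,3}` minus a vertex is `K_{2,3}`, and its three vertices of degree 2 may be labelled in any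
order. This is why the matching `σ` does not affect the isomorphism type in `starProduct_fbarOn`. -/
theorem exists_K33_labelling (b : Fin 3 ⊕ Fin 3) (τ : Fin 3 ≃ K33.neighborSet b) :
    ∃ g : Fin 3 ⊕ Fin 2 ≃ {y // y ≠ b}, (∀ i, (g (.inl i) : Fin 3 ⊕ Fin 3) = τ i) ∧
      ∀ p q, K33.Adj (g p) (g q) ↔ p.isLeft ≠ q.isLeft := by
  obtain ⟨ρ, hρi, hρ⟩ := exists_other_of_class b
  have hτ : ∀ i, (τ i : Fin 3 ⊕ Fin 3).isLeft = !b.isLeft := by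
    intro i
    have : K33.Adj b (τ i) := (τ i).2
    rw [K33_adj_iff] at this
    revert this
    cases b.isLeft <;> cases (τ i : Fin 3 ⊕ Fin 3).isLeft <;> simp
  let f : Fin 3 ⊕ Fin 2 → {y // y ≠ b} :=
    Sum.elim (fun i => ⟨τ i, (K33.ne_of_adj (τ i).2).symm⟩) fun c => ⟨ρ c, (hρ c).1⟩
  have hf : ∀ p, (f p : Fin 3 ⊕ Fin 3).isLeft = (p.isLeft ^^ b.isLeft) := by
    rintro (i | c)
    · simpa [f] using hτ i
    · simpa [f] using (hρ c).2
  have hinj : Function.Injective f := by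
    rintro (i | c) (i' | c') h
    · have := congrArg Subtype.val h
      exact congrArg _ (τ.injective (Subtype.ext this))
    · have := congrArg (fun y => (Subtype.val y).isLeft) h
      rw [hf, hf] at this
      simp at this
      cases b <;> simp at this
    · have := congrArg (fun y => (Subtype.val y).isLeft) h
      rw [hf, hf] at this
      simp at this
      cases b <;> simp at this
    · have := congrArg Subtype.val h
      exact congrArg _ (hρi this)
  have hbij : Function.Bijective f := by
    rw [Fintype.bijective_iff_injective_and_card]
    exact ⟨hinj, by simp⟩
  refine ⟨Equiv.ofBijective f hbij, fun i => rfl, fun p q => ?_⟩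
  rw [K33_adj_iff, Equiv.ofBijective_apply, Equiv.ofBijective_apply, hf, hf]
  simp

/-- The colour class is the neighbourhood of a vertex that is not replaced. -/
def classEquivNeighborSet (J : Type u) {U : Type v} (s : U) :
    Fin 3 ≃ (fbarOn J U).neighborSet (.inr (.inr s)) where
  toFun i := ⟨.inl i, by simp [fbarOn_adj, fbarPair]⟩
  invFun x := match x with
    | ⟨.inl i, _⟩ => i
    | ⟨.inr (.inl (_, .inl _)), h⟩ => False.elim (by simp [fbarOn_adj, fbarPair] at h)
    | ⟨.inr (.inl (_, .inr _)), h⟩ => False.elim (by simp [fbarOn_adj, fbarPair] at h)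
    | ⟨.inr (.inr _), h⟩ => False.elim (by simp [fbarOn_adj, fbarPair] at h)
  left_inv i := rfl
  right_inv := by
    rintro ⟨i | ⟨j, i | c⟩ | s, h⟩
    · rfl
    all_goals simp [fbarOn_adj, fbarPair] at h

theorem starProduct_fbarOn {J : Type u} {U : Type v} (s : U) (b : Fin 3 ⊕ Fin 3)
    (σ : (fbarOn J U).neighborSet (.inr (.inr s)) ≃ K33.neighborSet b) :
    Nonempty (starProduct (fbarOn J U) K33 (.inr (.inr s)) b σ ≃g
      fbarOn (Option J) {s' : U // s' ≠ s}) := by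
  obtain ⟨g, hg, hadj⟩ := exists_K33_labelling b ((classEquivNeighborSet J s).trans σ)
  have hcut : ∀ (x : {x : Fin 3 ⊕ (J × (Fin 3 ⊕ Fin 2)) ⊕ U // x ≠ .inr (.inr s)})
      (p : Fin 3 ⊕ Fin 2),
      (glue (fbarOn J U) K33 (.inr (.inr s)) b σ).Adj (.inl x) (.inr (g p)) ↔
        ∃ i, x.1 = .inl i ∧ p = .inl i := by
    rintro ⟨x, hx⟩ p
    rw [glue_adj_inl_inr]
    constructor
    · rintro ⟨-, h, e⟩
      obtain ⟨i, hi⟩ := (classEquivNeighborSet J s).surjective ⟨x, h⟩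
      refine ⟨i, (congrArg Subtype.val hi).symm, g.injective (Subtype.ext ?_)⟩
      rw [hg, Equiv.trans_apply, hi, e]
    · rintro ⟨i, rfl, rfl⟩
      have h := (classEquivNeighborSet J s i).2
      exact ⟨h, h, (hg i).symm⟩
  have hcut' : ∀ (x : {x : Fin 3 ⊕ (J × (Fin 3 ⊕ Fin 2)) ⊕ U // x ≠ .inr (.inr s)})
      (p : Fin 3 ⊕ Fin 2),
      (glue (fbarOn J U) K33 (.inr (.inr s)) b σ).Adj (.inr (g p)) (.inl x) ↔
        ∃ i, x.1 = .inl i ∧ p = .inl i := fun x p => by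
    rw [SimpleGraph.adj_comm, hcut]
  refine ⟨SimpleGraph.Iso.symm ?_⟩
  -- The new index `none` of `Option J` carries the copy of `K_{2,3}` that comes from the right
  -- factor.
  refine ⟨⟨fun x => match x with
      | .inl i => .inl ⟨.inl i, by simp⟩
      | .inr (.inl (some j, p)) => .inl ⟨.inr (.inl (j, p)), by simp⟩
      | .inr (.inl (none, p)) => .inr (g p)
      | .inr (.inr s') => .inl ⟨.inr (.inr s'), by simpa using s'.2⟩,
    fun y => match y with
      | .inl ⟨.inl i, _⟩ => .inl i
      | .inl ⟨.inr (.inl (j, p)), _⟩ => .inr (.inl (some j, p))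
      | .inl ⟨.inr (.inr s'), h⟩ => .inr (.inr ⟨s', by simpa using h⟩)
      | .inr q => .inr (.inl (none, g.symm q)), ?_, ?_⟩, ?_⟩
  · rintro (i | ⟨j | j, p⟩ | s') <;> simp
  · rintro (⟨i | ⟨j, p⟩ | s', h⟩ | q) <;> simp
  · rw [starProduct_eq_glue]
    rintro (i | ⟨_ | j, i | c⟩ | s') (i' | ⟨_ | j', i' | c'⟩ | s'') <;>
      simp [-completeBipartiteGraph_adj, -glue_adj_inl_inr, -glue_adj_inr_inl, hadj, hcut, hcut',
        fbarOn_adj, fbarPair, eq_comm]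

theorem starProduct_fbar (k : Fin 4) (s : Fin (3 - (k : ℕ))) (b : Fin 3 ⊕ Fin 3)
    (σ : (Fbar k).neighborSet (.inr (.inr s)) ≃ K33.neighborSet b) (k' : Fin 4)
    (hk : (k' : ℕ) = k + 1) :
    Nonempty (starProduct (Fbar k) K33 (.inr (.inr s)) b σ ≃g Fbar k') := by
  -- The graph is generalised because the type of `σ` depends on it.
  have key : ∀ (G : SimpleGraph (FbarVertex k)), G = fbarOn (Fin (k : ℕ)) (Fin (3 - (k : ℕ))) →
      ∀ σ : G.neighborSet (.inr (.inr s)) ≃ K33.neighborSet b,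
      Nonempty (starProduct G K33 (.inr (.inr s)) b σ ≃g
        fbarOn (Option (Fin (k : ℕ))) {s' : Fin (3 - (k : ℕ)) // s' ≠ s}) := by
    rintro _ rfl σ
    exact starProduct_fbarOn s b σ
  obtain ⟨e⟩ := key _ (fbar_eq_fbarOn k) σ
  rw [fbar_eq_fbarOn k']
  refine ⟨e.trans (fbarOnCongr (Fintype.equivOfCardEq ?_) (Fintype.equivOfCardEq ?_))⟩
  · simp [hk]
  · simp [hk]
    omega

/-- A star product depends on the left factor only up to isomorphism. -/
def starProductCongrLeft {V V' W : Type*} {G : SimpleGraph V} {G' : SimpleGraph V'}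
    {K : SimpleGraph W} (e : G ≃g G') (a : V) (b : W) (σ : G.neighborSet a ≃ K.neighborSet b) :
    starProduct G K a b σ ≃g
      starProduct G' K (e a) b ((e.mapNeighborSet a).symm.trans σ) where
  toEquiv := Equiv.sumCongr (e.toEquiv.subtypeEquiv fun x => not_congr e.injective.eq_iff.symm)
    (Equiv.refl _)
  map_rel_iff' := by
    rw [starProduct_eq_glue, starProduct_eq_glue]
    have hcut : ∀ (x : V) (y : W), (∃ h : e x ∈ G'.neighborSet (e a),
        ((((e.mapNeighborSet a).symm.trans σ) ⟨e x, h⟩ : K.neighborSet b) : W) = y) ↔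
        ∃ h : x ∈ G.neighborSet a, (σ ⟨x, h⟩ : W) = y := by
      intro x y
      have hs : ∀ h : x ∈ G.neighborSet a, ∀ h' : e x ∈ G'.neighborSet (e a),
          (e.mapNeighborSet a).symm ⟨e x, h'⟩ = ⟨x, h⟩ := fun h h' => by
        rw [Equiv.symm_apply_eq]
        rfl
      constructor
      · rintro ⟨h', hy⟩
        have h : x ∈ G.neighborSet a := e.map_adj_iff.1 h'
        refine ⟨h, ?_⟩
        rw [Equiv.trans_apply, hs h h'] at hy
        exact hy
      · rintro ⟨h, hy⟩
        have h' : e x ∈ G'.neighborSet (e a) := e.map_adj_iff.2 h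
        refine ⟨h', ?_⟩
        rw [Equiv.trans_apply, hs h h']
        exact hy
    rintro (p | p) (q | q)
    · exact (glue_adj_inl_inl _ _ _).trans (e.map_adj_iff.trans (glue_adj_inl_inl _ _ _).symm)
    · refine (glue_adj_inl_inr _ _ _).trans (.trans ?_ (glue_adj_inl_inr _ _ _).symm)
      exact and_congr e.map_adj_iff (hcut p q)
    · refine (glue_adj_inr_inl _ _ _).trans (.trans ?_ (glue_adj_inr_inl _ _ _).symm)
      exact and_congr e.map_adj_iff (hcut q p)
    · simp

/-- The colour classes of `Fbar 0`, which is `K_{3,3}`, may be exchanged. -/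
theorem exists_fbarZero_swap (i : Fin 3) :
    ∃ e : Fbar 0 ≃g Fbar 0, ∃ s, e (.inl i) = .inr (.inr s) := by
  refine ⟨⟨⟨fun x => match x with
      | .inl i => .inr (.inr i)
      | .inr (.inl p) => .inr (.inl p)
      | .inr (.inr i) => .inl i,
    fun x => match x with
      | .inl i => .inr (.inr i)
      | .inr (.inl p) => .inr (.inl p)
      | .inr (.inr i) => .inl i, ?_, ?_⟩, ?_⟩, i, rfl⟩
  · rintro (i | p | s) <;> rfl
  · rintro (i | p | s) <;> rfl
  · rintro (i | p | s) (i' | p' | s')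
    all_goals first | exact p.1.elim0 | exact p'.1.elim0 | simp [Fbar]

/-- The two copies of `K_{2,3}` in `Fbar 1` may be exchanged. -/
theorem exists_fbarOne_swap (j : Fin ((1 : Fin 4) : ℕ)) (c : Fin 2) :
    ∃ e : Fbar 1 ≃g Fbar 1, ∃ s, e (.inr (.inl (j, .inr c))) = .inr (.inr s) := by
  have hj : ∀ j j' : Fin ((1 : Fin 4) : ℕ), j = j' := by decide
  refine ⟨⟨⟨fun x => match x with
      | .inl i => .inr (.inl (j, .inl i))
      | .inr (.inl (_, .inl i)) => .inl i
      | .inr (.inl (_, .inr c)) => .inr (.inr c)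
      | .inr (.inr c) => .inr (.inl (j, .inr c)),
    fun x => match x with
      | .inl i => .inr (.inl (j, .inl i))
      | .inr (.inl (_, .inl i)) => .inl i
      | .inr (.inl (_, .inr c)) => .inr (.inr c)
      | .inr (.inr c) => .inr (.inl (j, .inr c)), ?_, ?_⟩, ?_⟩, c, rfl⟩
  · rintro (i | ⟨j', i | c⟩ | s)
    · rfl
    · rw [hj j' j]
    · rw [hj j' j]
    · rfl
  · rintro (i | ⟨j', i | c⟩ | s)
    · rfl
    · rw [hj j' j]
    · rw [hj j' j]
    · rfl
  · rintro (i | ⟨j₁, i | c⟩ | s) (i' | ⟨j₂, i' | c'⟩ | s')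
    all_goals simp [Fbar, eq_comm, hj _ j]

theorem fbar_zero_iso_K33 : Nonempty (Fbar 0 ≃g K33) := by
  refine ⟨⟨⟨fun x => match x with
      | .inl i => .inl i
      | .inr (.inl p) => p.1.elim0
      | .inr (.inr i) => .inr i,
    fun x => match x with
      | .inl i => .inl i
      | .inr i => .inr (.inr i), ?_, ?_⟩, ?_⟩⟩
  · rintro (i | p | s)
    · rfl
    · exact p.1.elim0
    · rfl
  · rintro (i | i) <;> rfl
  · rintro (i | p | s) (i' | p' | s')
    all_goals first | exact p.1.elim0 | exact p'.1.elim0 | simp [Fbar]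

/-- A star product of one of the exceptional graphs with `K_{3,3}` is exceptional, or it has an
almost `2`-factor. -/
theorem starProduct_of_iso_fbar {V : Type*} {G : SimpleGraph V} {k : Fin 4} (e : G ≃g Fbar k)
    (a : V) (b : Fin 3 ⊕ Fin 3) (σ : G.neighborSet a ≃ K33.neighborSet b) :
    (∃ H, IsAlmostTwoFactor (starProduct G K33 a b σ) H) ∨
      ∃ k', Nonempty (starProduct G K33 a b σ ≃g Fbar k') := by
  have single : ∀ (e : G ≃g Fbar k) s, e a = .inr (.inr s) →
      ∃ k', Nonempty (starProduct G K33 a b σ ≃g Fbar k') := by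
    intro e s hs
    have hlt : (k : ℕ) + 1 < 4 := by
      have := s.isLt
      omega
    have key : ∀ a', a' = .inr (.inr s) → ∀ σ' : (Fbar k).neighborSet a' ≃ K33.neighborSet b,
        Nonempty (starProduct (Fbar k) K33 a' b σ' ≃g Fbar ⟨k + 1, hlt⟩) := by
      rintro _ rfl σ'
      exact starProduct_fbar k s b σ' _ rfl
    obtain ⟨f⟩ := key _ hs ((e.mapNeighborSet a).symm.trans σ)
    exact ⟨_, ⟨(starProductCongrLeft e a b σ).trans f⟩⟩
  have lollipop : (∃ H ≤ Fbar k, ¬ H.Connected ∧ ∃ y, IsLollipop H (e a) y) →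
      ∃ H, IsAlmostTwoFactor (starProduct G K33 a b σ) H := by
    intro h
    obtain ⟨H, hH, hd, y, hy⟩ := exists_lollipop_iso e h
    exact exists_almostTwoFactor_of_lollipop isCubic_K33 (exists_isLollipop_K33 b) hH hd hy
  rcases ha : e a with i | ⟨j, i | c⟩ | s
  · by_cases hk : k = 0
    · subst hk
      obtain ⟨f, s, hs⟩ := exists_fbarZero_swap i
      exact .inr (single (e.trans f) s (by rw [← hs, ← ha]; rfl))
    · have hpos : 0 < (k : ℕ) := Fin.pos_iff_ne_zero.2 hk
      refine .inl (lollipop ?_)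
      rw [ha]
      exact exists_lollipop_class k ⟨0, hpos⟩ i
  · refine .inl (lollipop ?_)
    rw [ha]
    exact exists_lollipop_gadget k j i
  · by_cases hk : k = 1
    · subst hk
      obtain ⟨f, s, hs⟩ := exists_fbarOne_swap j c
      exact .inr (single (e.trans f) s (by rw [← hs, ← ha]; rfl))
    · have hj : ∃ j', j ≠ j' := by
        clear ha c lollipop single e
        revert k
        decide
      obtain ⟨j', hj'⟩ := hj
      refine .inl (lollipop ?_)
      rw [ha]
      exact exists_lollipop_hub k j j' hj' c
  · exact .inr (single e s ha)

end Isomorphisms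

/-! ### Large matchings do not separate the exceptional graphs -/

section Matchings

/-- The colour class of `Fbar k` that contains the colour class of `K_{3,3}` left untouched. -/
def fbarClass (k : Fin 4) : FbarVertex k → Bool
  | .inl _ => true
  | .inr (.inl (_, .inr _)) => true
  | _ => false

theorem fbarClass_ne_of_adj {k : Fin 4} {v w : FbarVertex k} (h : (Fbar k).Adj v w) :
    fbarClass k v = true ∨ fbarClass k w = true := by
  rcases v with i | ⟨j, i | c⟩ | s <;> rcases w with i' | ⟨j', i' | c'⟩ | s' <;>
    simp_all [Fbar, fbarClass]

theorem card_fbarClass_erase_hubs (k : Fin 4) (j : Fin (k : ℕ)) :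
    (Finset.univ.filter fun v => fbarClass k v = true ∧ v ≠ .inr (.inl (j, .inr 0)) ∧
      v ≠ .inr (.inl (j, .inr 1))).card = 1 + 2 * (k : ℕ) := by
  revert k j
  decide +kernel

/-- A large matching covers one of the two vertices of degree `3` of each copy of `K_{2,3}`. -/
theorem exists_covered_hub {k : Fin 4} {M : (Fbar k).Subgraph} (hM : M.IsMatching)
    (hk : 2 + 2 * (k : ℕ) ≤ M.edgeSet.ncard) (j : Fin (k : ℕ)) :
    ∃ c i, M.Adj (.inr (.inl (j, .inr c))) (.inr (.inl (j, .inl i))) := by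
  have hcov : ∃ c w, M.Adj (.inr (.inl (j, .inr c))) w := by
    by_contra hno
    push Not at hno
    classical
    -- Each covered vertex is sent to its matching edge, with a loop as default value. Every edge
    -- has an end in the class; if neither hub of `j` is covered, this leaves only `1 + 2k` edges.
    let g : FbarVertex k → Sym2 (FbarVertex k) := fun v =>
      if h : ∃ w, M.Adj v w then s(v, h.choose) else s(v, v)
    let S : Finset (FbarVertex k) := Finset.univ.filter fun v =>
      fbarClass k v = true ∧ v ≠ .inr (.inl (j, .inr 0)) ∧ v ≠ .inr (.inl (j, .inr 1))
    have hS : S.card = 1 + 2 * (k : ℕ) := card_fbarClass_erase_hubs k j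
    have hg : ∀ v w, M.Adj v w → fbarClass k v = true →
        s(v, w) ∈ g '' (S : Set (FbarVertex k)) := by
      intro v w h hv
      have hex : ∃ w, M.Adj v w := ⟨w, h⟩
      refine ⟨v, ?_, ?_⟩
      · simp only [S, Finset.coe_filter, Finset.mem_univ, true_and, Set.mem_ofPred_eq]
        refine ⟨hv, ?_, ?_⟩ <;> rintro rfl
        exacts [hno _ _ h, hno _ _ h]
      · simp only [g, dif_pos hex]
        rw [hM.eq_of_adj_left hex.choose_spec h]
    have hsub : M.edgeSet ⊆ g '' (S : Set (FbarVertex k)) := by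
      intro e
      induction e with
      | h v w =>
        intro he
        have h : M.Adj v w := he
        rcases fbarClass_ne_of_adj (M.adj_sub h) with hv | hw
        · exact hg v w h hv
        · rw [Sym2.eq_swap]
          exact hg w v h.symm hw
    have h1 := Set.ncard_le_ncard hsub (Set.toFinite _)
    have h2 := Set.ncard_image_le (f := g) (s := (S : Set (FbarVertex k))) (Set.toFinite _)
    rw [Set.ncard_coe_finset] at h2
    omega
  obtain ⟨c, w, h⟩ := hcov
  have hadj := M.adj_sub h
  rcases w with i' | ⟨j', i' | c'⟩ | s'
  · simp [Fbar] at hadj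
  · have : j' = j := by simpa [Fbar] using hadj
    subst this
    exact ⟨c, i', h⟩
  · simp [Fbar] at hadj
  · simp [Fbar] at hadj

/-- The vertex through which the slot `s` is joined to the `i`-th vertex of the colour class. -/
def port {k : Fin 4} (i : Fin 3) : Fin (k : ℕ) ⊕ Fin (3 - (k : ℕ)) → FbarVertex k
  | .inl j => .inr (.inl (j, .inl i))
  | .inr s => .inr (.inr s)

/-- A vertex in the slot `s` that does not depend on the colour class. -/
def slotCenter {k : Fin 4} : Fin (k : ℕ) ⊕ Fin (3 - (k : ℕ)) → FbarVertex k
  | .inl j => .inr (.inl (j, .inr 0))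
  | .inr s => .inr (.inr s)

theorem fbar_adj_port {k : Fin 4} (i : Fin 3) (s : Fin (k : ℕ) ⊕ Fin (3 - (k : ℕ))) :
    (Fbar k).Adj (.inl i) (port i s) := by
  rcases s with j | s <;> simp [Fbar, port]

theorem port_injective {k : Fin 4} (i : Fin 3) : Function.Injective (port (k := k) i) := by
  rintro (j | s) (j' | s') h <;> simp_all [port]

theorem fbar_adj_hub {k : Fin 4} (j : Fin (k : ℕ)) (i : Fin 3) (c : Fin 2) :
    (Fbar k).Adj (.inr (.inl (j, .inr c))) (.inr (.inl (j, .inl i))) := by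
  simp [Fbar]

/-- Deleting a matching that covers one of the vertices of degree `3` of a copy of `K_{2,3}` leaves
this copy connected. -/
theorem reachable_gadget {k : Fin 4} {M : (Fbar k).Subgraph} (hM : M.IsMatching)
    {j : Fin (k : ℕ)} {c : Fin 2} {i : Fin 3}
    (h : M.Adj (.inr (.inl (j, .inr c))) (.inr (.inl (j, .inl i)))) (p : Fin 3 ⊕ Fin 2) :
    ((Fbar k).deleteEdges M.edgeSet).Reachable (.inr (.inl (j, p))) (.inr (.inl (j, .inr c))) := by
  have adj : ∀ c' i', ¬ M.Adj (.inr (.inl (j, .inr c'))) (.inr (.inl (j, .inl i'))) →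
      ((Fbar k).deleteEdges M.edgeSet).Reachable
        (.inr (.inl (j, .inr c'))) (.inr (.inl (j, .inl i'))) := by
    intro c' i' hn
    refine SimpleGraph.Adj.reachable ?_
    rw [SimpleGraph.deleteEdges_adj]
    exact ⟨fbar_adj_hub j i' c', hn⟩
  have hB : ∀ i', i' ≠ i → ((Fbar k).deleteEdges M.edgeSet).Reachable
      (.inr (.inl (j, .inl i'))) (.inr (.inl (j, .inr c))) := by
    intro i' hi'
    refine (adj c i' fun hm => hi' ?_).symm
    simpa using hM.eq_of_adj_left hm h
  have hC : ∀ c', ((Fbar k).deleteEdges M.edgeSet).Reachable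
      (.inr (.inl (j, .inr c'))) (.inr (.inl (j, .inr c))) := by
    intro c'
    have hne : ∀ i : Fin 3, i + 1 ≠ i ∧ i + 2 ≠ i ∧ i + 1 ≠ i + 2 := by decide
    replace hne := hne i
    -- The other hub loses at most one edge, so it keeps one to `i + 1` or `i + 2`, both of which
    -- remain joined to the hub `c`.
    by_cases hm : M.Adj (.inr (.inl (j, .inr c'))) (.inr (.inl (j, .inl (i + 1))))
    · refine (adj c' (i + 2) fun hm' => hne.2.2 ?_).trans (hB _ hne.2.1)
      simpa using hM.eq_of_adj_left hm hm'
    · exact (adj c' _ hm).trans (hB _ hne.1)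
  rcases p with i' | c'
  · by_cases hi : i' = i
    · subst hi
      obtain ⟨c', hc'⟩ := exists_ne c
      refine (adj c' i' fun hm => hc' ?_).symm.trans (hC c')
      simpa using hM.eq_of_adj_left hm.symm h.symm
    · exact hB i' hi
  · exact hC c'

/-- Deleting a large matching from one of the exceptional graphs leaves a connected graph. -/
theorem connected_fbar_deleteEdges {k : Fin 4} {M : (Fbar k).Subgraph} (hM : M.IsMatching)
    (hk : 2 + 2 * (k : ℕ) ≤ M.edgeSet.ncard) :
    ((Fbar k).deleteEdges M.edgeSet).Connected := by
  have hgad : ∀ j p q, ((Fbar k).deleteEdges M.edgeSet).Reachable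
      (.inr (.inl (j, p))) (.inr (.inl (j, q))) := by
    intro j p q
    obtain ⟨c, i, h⟩ := exists_covered_hub hM hk j
    exact (reachable_gadget hM h p).trans (reachable_gadget hM h q).symm
  have hport : ∀ i s, ¬ M.Adj (.inl i) (port i s) →
      ((Fbar k).deleteEdges M.edgeSet).Reachable (.inl i) (slotCenter s) := by
    intro i s hn
    have h : ((Fbar k).deleteEdges M.edgeSet).Adj (.inl i) (port i s) := by
      rw [SimpleGraph.deleteEdges_adj]
      exact ⟨fbar_adj_port i s, hn⟩
    refine h.reachable.trans ?_
    rcases s with j | s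
    · exact hgad _ _ _
    · exact .rfl
  -- In a copy, the vertex matched to a hub keeps its edge to the class; an unreplaced vertex loses
  -- at most one of its three edges.
  have hslot : ∀ s : Fin (k : ℕ) ⊕ Fin (3 - (k : ℕ)), ∃ i, ¬ M.Adj (.inl i) (port i s) := by
    rintro (j | s)
    · obtain ⟨c, i, h⟩ := exists_covered_hub hM hk j
      refine ⟨i, fun hm => ?_⟩
      simpa using hM.eq_of_adj_left h.symm hm.symm
    · by_contra hno
      push Not at hno
      simpa using hM.eq_of_adj_left (hno 0).symm (hno 1).symm
  have hclass : ∀ i i', ((Fbar k).deleteEdges M.edgeSet).Reachable (.inl i) (.inl i') := by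
    intro i i'
    obtain ⟨e⟩ : Nonempty (Fin 3 ≃ Fin (k : ℕ) ⊕ Fin (3 - (k : ℕ))) :=
      ⟨Fintype.equivOfCardEq (by simp; omega)⟩
    -- Each vertex of the class keeps its edges to at least two of the three slots, so any two of
    -- them share a slot.
    by_cases hex : ∃ s, ¬ M.Adj (.inl i) (port i s) ∧ ¬ M.Adj (.inl i') (port i' s)
    · obtain ⟨s, h, h'⟩ := hex
      exact (hport i s h).trans (hport i' s h').symm
    · exfalso
      push Not at hex
      have huniq : ∀ i t t', M.Adj (.inl i) (port i (e t)) → M.Adj (.inl i) (port i (e t')) →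
          t = t' := fun i t t' h h' =>
        e.injective (port_injective i (hM.eq_of_adj_left h h'))
      have h0 := hex (e 0)
      have h1 := hex (e 1)
      have h2 := hex (e 2)
      have n01 : (0 : Fin 3) ≠ 1 := by decide
      have n02 : (0 : Fin 3) ≠ 2 := by decide
      have n12 : (1 : Fin 3) ≠ 2 := by decide
      have a01 := fun i h h' => n01 (huniq i 0 1 h h')
      have a02 := fun i h h' => n02 (huniq i 0 2 h h')
      have a12 := fun i h h' => n12 (huniq i 1 2 h h')
      by_cases b0 : M.Adj (.inl i) (port i (e 0))
      · exact a12 i' (h1 fun h => a01 i b0 h) (h2 fun h => a02 i b0 h)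
      · by_cases b1 : M.Adj (.inl i) (port i (e 1))
        · exact a02 i' (h0 b0) (h2 fun h => a12 i b1 h)
        · exact a01 i' (h0 b0) (h1 b1)
  have hcenter : ∀ s, ((Fbar k).deleteEdges M.edgeSet).Reachable (slotCenter s) (.inl 0) := by
    intro s
    obtain ⟨i, hi⟩ := hslot s
    exact (hport i s hi).symm.trans (hclass i 0)
  have hall : ∀ v, ((Fbar k).deleteEdges M.edgeSet).Reachable v (.inl 0) := by
    rintro (i | ⟨j, p⟩ | s)
    · exact hclass i 0
    · exact (hgad j p (.inr 0)).trans (hcenter (.inl j))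
    · exact hcenter (.inr s)
  have : Nonempty (FbarVertex k) := ⟨.inl 0⟩
  exact ⟨fun v w => (hall v).trans (hall w).symm⟩

end Matchings

/-! ### From almost 2-factors to separating matchings, and the induction -/

section Main

variable {V : Type u}

theorem bddAbove_separatingMatching [Finite V] (G : SimpleGraph V) :
    BddAbove {k : ℕ | ∃ M : G.Subgraph, IsSeparatingMatching G M ∧ M.edgeSet.ncard = k} := by
  refine ⟨(Set.univ : Set (Sym2 V)).ncard, ?_⟩
  rintro _ ⟨M, -, rfl⟩
  exact Set.ncard_le_ncard (Set.subset_univ _) (Set.toFinite _)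

theorem card_connectedComponent_eq_one {G : SimpleGraph V} (h : G.Connected) :
    Nat.card G.ConnectedComponent = 1 := by
  have := h.preconnected.subsingleton_connectedComponent
  have : Nonempty G.ConnectedComponent := h.nonempty.map G.connectedComponentMk
  exact Nat.card_eq_one_iff_unique.2 ⟨inferInstance, inferInstance⟩

theorem one_lt_card_connectedComponent [Finite V] [Nonempty V] {G : SimpleGraph V}
    (h : ¬ G.Connected) : 1 < Nat.card G.ConnectedComponent := by
  rw [Finite.one_lt_card_iff_nontrivial]
  by_contra hn
  rw [not_nontrivial_iff_subsingleton] at hn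
  exact h ⟨fun v w => SimpleGraph.ConnectedComponent.exact (Subsingleton.elim _ _)⟩

/-- The edges of `G` outside of `H`, as a subgraph without isolated vertices. -/
def complementSubgraph (G H : SimpleGraph V) : G.Subgraph where
  verts := {v | ∃ w, G.Adj v w ∧ ¬ H.Adj v w}
  Adj v w := G.Adj v w ∧ ¬ H.Adj v w
  adj_sub h := h.1
  edge_vert h := ⟨_, h⟩
  symm := ⟨fun _ _ h => ⟨h.1.symm, fun h' => h.2 h'.symm⟩⟩

theorem deleteEdges_complementSubgraph {G H : SimpleGraph V} (h : H ≤ G) :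
    G.deleteEdges (complementSubgraph G H).edgeSet = H := by
  ext v w
  rw [SimpleGraph.deleteEdges_adj, SimpleGraph.Subgraph.mem_edgeSet]
  simp only [complementSubgraph]
  exact ⟨fun h' => by tauto, fun h' => ⟨h h', fun h'' => h''.2 h'⟩⟩

theorem isMatching_complementSubgraph {G H : SimpleGraph V} (hG : IsCubic G) (h : H ≤ G) {p q : V}
    (hb : IsBicubic H p q) : (complementSubgraph G H).IsMatching := by
  obtain ⟨-, hp, hq, h2⟩ := hb
  rintro v ⟨w, hw, hn⟩
  have hvp : v ≠ p := by
    rintro rfl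
    exact hn (adj_of_ncard_eq_three h (hG v) hp hw)
  have hvq : v ≠ q := by
    rintro rfl
    exact hn (adj_of_ncard_eq_three h (hG v) hq hw)
  obtain ⟨x, hx, hx'⟩ := exists_missing_neighbor h (hG v) (h2 v hvp hvq)
  refine ⟨x, ⟨hx, fun h => (hx' x hx).1 h rfl⟩, fun y hy => ?_⟩
  by_contra hne
  exact hy.2 ((hx' y hy.1).2 hne)

/-- The complement has degree 0 at `p` and `q` and degree 1 elsewhere; the count is the handshake
lemma. -/
theorem card_edgeSet_complementSubgraph [Fintype V] {G H : SimpleGraph V} (hG : IsCubic G)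
    (h : H ≤ G) {p q : V} (hb : IsBicubic H p q) :
    Fintype.card V = 2 * (complementSubgraph G H).edgeSet.ncard + 2 := by
  classical
  obtain ⟨hpq, hp, hq, h2⟩ := hb
  have hsum := (complementSubgraph G H).spanningCoe.sum_degrees_eq_twice_card_edges
  have hdeg : ∀ v, (complementSubgraph G H).spanningCoe.degree v =
      if v = p ∨ v = q then 0 else 1 := by
    intro v
    have hns : (complementSubgraph G H).spanningCoe.neighborSet v =
        G.neighborSet v \ H.neighborSet v := rfl
    have hsub : H.neighborSet v ⊆ G.neighborSet v := fun z hz => h hz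
    rw [← SimpleGraph.card_neighborSet_eq_degree, ← Nat.card_eq_fintype_card,
      Nat.card_coe_set_eq, hns, Set.ncard_sdiff hsub (Set.toFinite _), hG v]
    split_ifs with hv
    · rcases hv with rfl | rfl
      · rw [hp]
      · rw [hq]
    · rw [h2 v (fun h => hv (.inl h)) (fun h => hv (.inr h))]
  have hedge : (complementSubgraph G H).spanningCoe.edgeFinset.card =
      (complementSubgraph G H).edgeSet.ncard := by
    rw [← SimpleGraph.Subgraph.edgeSet_spanningCoe, ← SimpleGraph.coe_edgeFinset,
      Set.ncard_coe_finset]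
  have hcount : (∑ v : V, if v = p ∨ v = q then 0 else 1) + 2 = Fintype.card V := by
    have hpair : (∑ v : V, if v = p ∨ v = q then 1 else 0) = 2 := by
      rw [← Finset.sum_filter, Finset.sum_const, smul_eq_mul, mul_one,
        ← Finset.card_pair hpq]
      congr 1
      ext
      simp
    rw [← hpair, ← Finset.sum_add_distrib, Fintype.card_eq_sum_ones]
    refine Finset.sum_congr rfl fun v _ => ?_
    split_ifs <;> rfl
  simp only [hdeg] at hsum
  rw [hedge] at hsum
  omega

/-- The edges outside of an almost `2`-factor form a large separating matching. -/
theorem le_mms_of_almostTwoFactor [Fintype V] {G : SimpleGraph V} (hG : IsCubic G)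
    (hc : G.Connected) (h : ∃ H, IsAlmostTwoFactor G H) :
    (mms G : ℚ) ≥ (Fintype.card V : ℚ) / 2 - 1 := by
  obtain ⟨H, hH⟩ := h
  obtain ⟨hle, hd, p, q, hb⟩ := isAlmostTwoFactor_iff.1 hH
  have := hc.nonempty
  have hmem : (complementSubgraph G H).edgeSet.ncard ≤ mms G := by
    refine le_csSup (bddAbove_separatingMatching G) ⟨complementSubgraph G H,
      ⟨isMatching_complementSubgraph hG hle hb, ?_⟩, rfl⟩
    rw [deleteEdges_complementSubgraph hle, card_connectedComponent_eq_one hc]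
    exact one_lt_card_connectedComponent hd
  have hcard := card_edgeSet_complementSubgraph hG hle hb
  have h1 : ((complementSubgraph G H).edgeSet.ncard : ℚ) ≤ mms G := by exact_mod_cast hmem
  rw [hcard]
  push_cast
  linarith

theorem card_fbarVertex (k : Fin 4) : Fintype.card (FbarVertex k) = 6 + 4 * (k : ℕ) := by
  simp
  omega

/-- The exceptional graphs have no large separating matching. -/
theorem mms_lt_of_iso_fbar [Fintype V] {G : SimpleGraph V} {k : Fin 4} (e : G ≃g Fbar k) :
    ¬ (mms G : ℚ) ≥ (Fintype.card V : ℚ) / 2 - 1 := by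
  intro h
  rw [Fintype.card_congr e.toEquiv, card_fbarVertex] at h
  have hk : 2 + 2 * (k : ℕ) ≤ mms G := by
    push_cast at h
    have : ((2 + 2 * (k : ℕ) : ℕ) : ℚ) ≤ (mms G : ℚ) := by
      push_cast
      linarith
    exact_mod_cast this
  -- With no separating matching `mms` would be 0, which is less than `2 + 2k`; hence the supremum
  -- is attained.
  have hne :
      {k : ℕ | ∃ M : G.Subgraph, IsSeparatingMatching G M ∧ M.edgeSet.ncard = k}.Nonempty := by
    by_contra hempty
    rw [Set.not_nonempty_iff_eq_empty] at hempty
    rw [mms, hempty, csSup_empty, bot_eq_zero] at hk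
    omega
  obtain ⟨M, ⟨hM, hsep⟩, hcard⟩ := Nat.sSup_mem hne (bddAbove_separatingMatching G)
  have hM' : (M.map e.toHom).IsMatching := hM.map e.toHom e.injective
  have hedges : (M.map e.toHom).edgeSet = Sym2.map e '' M.edgeSet :=
    SimpleGraph.Subgraph.edgeSet_map _ _
  have hinj : Function.Injective (Sym2.map e) := Sym2.map.injective e.injective
  have hcon : ((Fbar k).deleteEdges (M.map e.toHom).edgeSet).Connected := by
    refine connected_fbar_deleteEdges hM' ?_
    rw [hedges, Set.ncard_image_of_injective _ hinj, hcard]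
    exact hk
  let f : G.deleteEdges M.edgeSet ≃g (Fbar k).deleteEdges (M.map e.toHom).edgeSet :=
    { toEquiv := e.toEquiv
      map_rel_iff' := by
        intro v w
        rw [SimpleGraph.deleteEdges_adj, SimpleGraph.deleteEdges_adj, hedges]
        refine and_congr e.map_adj_iff (not_congr ?_)
        exact hinj.mem_set_image (s := M.edgeSet) (a := s(v, w)) }
  have hcon' := connected_iso f.symm hcon
  rw [card_connectedComponent_eq_one hcon'] at hsep
  have := hcon'.nonempty
  have : Nonempty G.ConnectedComponent := this.map G.connectedComponentMk
  have := Nat.card_pos (α := G.ConnectedComponent)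
  omega

/-- The properties of the graphs in the class that the induction needs. -/
structure Admissible (G : SimpleGraph V) : Prop where
  isCubic : IsCubic G
  connected : G.Connected
  edgesAvoidable : EdgesAvoidable G
  almostTwoFactor_or_iso : (∃ H, IsAlmostTwoFactor G H) ∨ ∃ k, Nonempty (G ≃g Fbar k)

theorem Admissible.of_iso {W : Type v} {G : SimpleGraph V} {G' : SimpleGraph W} (e : G ≃g G')
    (h : Admissible G') : Admissible G where
  isCubic := isCubic_iso e h.isCubic
  connected := connected_iso e.symm h.connected
  edgesAvoidable := edgesAvoidable_iso e h.edgesAvoidable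
  almostTwoFactor_or_iso := h.almostTwoFactor_or_iso.imp (exists_almostTwoFactor_iso e)
    fun ⟨k, ⟨f⟩⟩ => ⟨k, ⟨e.trans f⟩⟩

theorem admissible_heawood : Admissible heawood where
  isCubic := isCubic_heawood
  connected := connected_heawood
  edgesAvoidable := edgesAvoidable_heawood
  almostTwoFactor_or_iso := by
    obtain ⟨H, hH, hd, p, q, hb, -⟩ := exists_almostTwoFactor_heawood (.inl 0)
    exact .inl ⟨H, isAlmostTwoFactor_iff.2 ⟨hH, hd, p, q, hb⟩⟩

theorem admissible_K33 : Admissible K33 where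
  isCubic := isCubic_K33
  connected := connected_K33
  edgesAvoidable := edgesAvoidable_K33
  almostTwoFactor_or_iso := .inr ⟨0, fbar_zero_iso_K33.map SimpleGraph.Iso.symm⟩

/-- The almost 2-factor comes from the Heawood side, whether or not `G` is exceptional. -/
theorem Admissible.starProduct_heawood {G : SimpleGraph V} (h : Admissible G) (a : V)
    (b : ZMod 7 ⊕ ZMod 7) (σ : G.neighborSet a ≃ heawood.neighborSet b) :
    Admissible (starProduct G heawood a b σ) where
  isCubic := isCubic_starProduct h.isCubic isCubic_heawood
  connected := by
    obtain ⟨y₀, hy₀⟩ := reachable_induce_heawood b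
    exact connected_starProduct h.connected y₀ hy₀
  edgesAvoidable := edgesAvoidable_starProduct h.isCubic isCubic_heawood h.edgesAvoidable
    edgesAvoidable_heawood
  almostTwoFactor_or_iso := by
    obtain ⟨H, hH, hd, p, q, hb, hp, hq⟩ := exists_almostTwoFactor_heawood b
    exact .inl (exists_almostTwoFactor_of_right h.isCubic isCubic_heawood h.edgesAvoidable hH hd hb
      hp hq)

theorem Admissible.starProduct_K33 {G : SimpleGraph V} (h : Admissible G) (a : V)
    (b : Fin 3 ⊕ Fin 3) (σ : G.neighborSet a ≃ K33.neighborSet b) :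
    Admissible (starProduct G K33 a b σ) where
  isCubic := isCubic_starProduct h.isCubic isCubic_K33
  connected := by
    obtain ⟨y₀, hy₀⟩ := reachable_induce_K33 b
    exact connected_starProduct h.connected y₀ hy₀
  edgesAvoidable := edgesAvoidable_starProduct h.isCubic isCubic_K33 h.edgesAvoidable
    edgesAvoidable_K33
  almostTwoFactor_or_iso := by
    rcases h.almostTwoFactor_or_iso with hA | ⟨k, ⟨e⟩⟩
    · exact .inl (exists_almostTwoFactor_of_left h.isCubic isCubic_K33 edgesAvoidable_K33
        (exists_isBicubic_K33 b) hA)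
    · exact starProduct_of_iso_fbar e a b σ

theorem FunkClass.admissible {G : SimpleGraph V} (h : FunkClass G) : Admissible G := by
  induction h with
  | heawood e => exact admissible_heawood.of_iso e
  | k33 e => exact admissible_K33.of_iso e
  | starHeawood _ a b σ e ih => exact (ih.starProduct_heawood a b σ).of_iso e
  | starK33 _ a b σ e ih => exact (ih.starProduct_K33 a b σ).of_iso e

theorem funkClass_fbar_succ {k k' : Fin 4} (hk : (k' : ℕ) = k + 1) (h : FunkClass (Fbar k)) :
    FunkClass (Fbar k') := by
  have hs : 0 < 3 - (k : ℕ) := by omega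
  let a : FbarVertex k := .inr (.inr ⟨0, hs⟩)
  -- Any bijection between the two neighbourhoods will do.
  obtain ⟨σ⟩ : Nonempty ((Fbar k).neighborSet a ≃ K33.neighborSet (.inl 0)) := by
    rw [← Finite.card_eq, Nat.card_coe_set_eq, Nat.card_coe_set_eq, h.admissible.isCubic,
      isCubic_K33]
  obtain ⟨e⟩ := starProduct_fbar k ⟨0, hs⟩ (.inl 0) σ k' hk
  exact .starK33 h a (.inl 0) σ e.symm

theorem funkClass_fbar (k : Fin 4) : FunkClass (Fbar k) := by
  obtain ⟨e⟩ := fbar_zero_iso_K33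
  have h0 : FunkClass (Fbar 0) := .k33 e
  have h1 : FunkClass (Fbar 1) := funkClass_fbar_succ rfl h0
  have h2 : FunkClass (Fbar 2) := funkClass_fbar_succ rfl h1
  have h3 : FunkClass (Fbar 3) := funkClass_fbar_succ rfl h2
  fin_cases k
  exacts [h0, h1, h2, h3]

end Main

end SeparatingMatching

theorem theorem4 :
    (∀ k : Fin 4, FunkClass (Fbar k)) ∧
    ∀ (V : Type u) [Fintype V] (G : SimpleGraph V), FunkClass G →
      (((mms G : ℚ) ≥ (Fintype.card V : ℚ) / 2 - 1 ↔ ∀ k : Fin 4, IsEmpty (G ≃g Fbar k)) ∧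
        ((∃ H : SimpleGraph V, IsAlmostTwoFactor G H) ↔ ∀ k : Fin 4, IsEmpty (G ≃g Fbar k))) := by
  refine ⟨funkClass_fbar, fun V _ G hG => ?_⟩
  have hA := hG.admissible
  have h1 : (∃ H, IsAlmostTwoFactor G H) → (mms G : ℚ) ≥ (Fintype.card V : ℚ) / 2 - 1 :=
    le_mms_of_almostTwoFactor hA.isCubic hA.connected
  have h2 : (mms G : ℚ) ≥ (Fintype.card V : ℚ) / 2 - 1 → ∀ k : Fin 4, IsEmpty (G ≃g Fbar k) :=
    fun h k => ⟨fun e => mms_lt_of_iso_fbar e h⟩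
  have h3 : (∀ k : Fin 4, IsEmpty (G ≃g Fbar k)) → ∃ H, IsAlmostTwoFactor G H := fun h =>
    hA.almostTwoFactor_or_iso.resolve_right fun ⟨k, ⟨e⟩⟩ => (h k).false e
  exact ⟨⟨h2, fun h => h1 (h3 h)⟩, ⟨fun h => h2 (h1 h), h3⟩⟩
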